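/- Let $M=\Gamma\backslash G$ be a nilmanifold ($G$ a simply connected Lie group of dimension 6, $\Gamma$ a discrete cocompact subgroup) whose Lie algebra $\mathfrak g$ is isomorphic to $\mathfrak h_5=(0,0,0,0,13+42,14+23)$, i.e. $\mathfrak g^*$ has a basis with $de^1=\dots=de^4=0$, $de^5=e^{13}-e^{24}$, $de^6=e^{14}+e^{23}$, where $e^{ij}=e^i\wedge e^j$ and $d$ is the Chevalley–Eilenberg differential. Invariant tensors on $M$ are identified with tensors on $\mathfrak g$. Let $J$ be an abelian complex structure on $M$, i.e. $J\in\operatorname{End}(\mathfrak g)$, $J^2=-1$, $J$ integrable and $[JX,JY]=[X,Y]$ for all $X,Y$, and let $g$ be any invariant $J$-Hermitian metric which is balanced: $F\wedge dF=0$ for $F(X,Y)=g(X,JY)$. Put $T(X,Y,Z)=-dF(JX,JY,JZ)$ and let $\nabla$ be the Bismut connection, i.e. the unique connection with $\nabla g=0$, $\nabla J=0$ and $g(X,\operatorname{Tor}^{\nabla}(Y,Z))=T(X,Y,Z)$; it exists and is invariant. Call a basis $e^1,\dots,e^6$ of $\mathfrak g^*$, with dual basis $e_1,\dots,e_6$ of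 $\mathfrak g$, adapted if $Je^1=-e^2$, $Je^3=-e^4$, $Je^5=-e^6$ (where $(J\alpha)(X)=-\alpha(JX)$) and $F=e^{12}+e^{34}+e^{56}$. Put $\gamma_1=e^{12}-e^{34}$, $\gamma_2=e^{13}+e^{24}$, $\gamma_3=e^{14}-e^{23}$. Then: (1) There is an adapted basis with $de^1=\dots=de^4=0$ which satisfies one of the following. (A) $de^5=\frac ts\gamma_2$ and $de^6=-2t\gamma_1-\frac ts\gamma_3$ for some real $s,t\neq0$. (B) For some real $s$, $t\ne0$ and some $u=u_1+iu_2\in\mathbb C$ with $s^2>|u|^2>0$, and with $Y=\frac{2\sqrt{s^2-|u|^2}}{|u|t}$, $$de^5=sY\left[2u_1|u|\gamma_1-tu_1|u|Y\gamma_2-2su_2\gamma_3\right],\qquad de^6=sY\left[2(2s^2-u_2)|u|\gamma_1+tu_2|u|Y\gamma_2-2su_1\gamma_3\right].$$ (2) For every adapted basis as in (1), let $\Psi=(e^1+ie^2)\wedge(e^3+ie^4)\wedge(e^5+ie^6)$ and, for $\lambda\in\mathbb R$, let $A_\lambda$ be the invariant connection on $TM$ whose connection 1-forms ($A_Xe_j=\sum_i\sigma^i_j(X)e_i$)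 are $\sigma^1_2=-\sigma^2_1=-\sigma^3_4=\sigma^4_3=\lambda(e^5+e^6)$, all others being zero. There is $\lambda_0>0$ such that for every real $\lambda$ with $0<|\lambda|<\lambda_0$ there is $\alpha'>0$ for which $(J,F,\Psi)$ and $A_\lambda$ solve the Strominger system with constant dilaton, with respect to the Bismut connection: (a) the holonomy group of $\nabla$ on $M$ is contained in $SU(3)$, the stabilizer of $(J,g,\Psi)$; (b) the Hermitian structure $(J,F)$ is balanced; (c) $A_\lambda$ is a non-flat $SU(3)$-instanton: it preserves $J$, $g$ and $\Psi$, and all its curvature 2-forms $\Omega^i_j=d\sigma^i_j+\sum_k\sigma^i_k\wedge\sigma^k_j$ satisfy $\Omega^i_j(e_1,e_2)+\Omega^i_j(e_3,e_4)+\Omega^i_j(e_5,e_6)=0$ and $\Omega^i_j(JX,JY)=\Omega^i_j(X,Y)$; (d) $dT=2\pi^2\alpha'\left(p_1(\nabla)-p_1(A_\lambda)\right)$, where $p_1=\frac1{8\pi^2}\sum_{1\le i<j\le6}\Omega^i_j\wedge\Omega^i_j$. -/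

import Mathlib

open scoped Manifold ContDiff

/-!
Invariant balanced Hermitian geometry on six-dimensional nilmanifolds `M = Γ \ G`.

Invariant tensors on `M` are tensors on the Lie algebra of `G`, i.e. on the space of left-invariant
vector fields; on invariant forms the exterior derivative is the Chevalley-Eilenberg differential.
-/

section Forms

variable {L : Type*} [LieRing L] [LieAlgebra ℝ L]

/-- Wedge product of two 1-forms. -/
def wedge11 (a b : L → ℝ) (X Y : L) : ℝ := a X * b Y - a Y * b X

/-- Wedge product of two 2-forms. -/
def wedge22 (a b : L → L → ℝ) (X Y Z W : L) : ℝ :=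
  a X Y * b Z W - a X Z * b Y W + a X W * b Y Z
    + a Y Z * b X W - a Y W * b X Z + a Z W * b X Y

/-- Wedge product of a 2-form and a 3-form. -/
def wedge23 (a : L → L → ℝ) (b : L → L → L → ℝ) (V X Y Z W : L) : ℝ :=
  a V X * b Y Z W - a V Y * b X Z W + a V Z * b X Y W - a V W * b X Y Z
    + a X Y * b V Z W - a X Z * b V Y W + a X W * b V Y Z
    + a Y Z * b V X W - a Y W * b V X Z + a Z W * b V X Y

/-- Chevalley-Eilenberg differential of a 1-form. -/
def d1 (a : L → ℝ) (X Y : L) : ℝ := -a ⁅X, Y⁆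

/-- Chevalley-Eilenberg differential of a 2-form. -/
def d2 (a : L → L → ℝ) (X Y Z : L) : ℝ := -a ⁅X, Y⁆ Z + a ⁅X, Z⁆ Y - a ⁅Y, Z⁆ X

/-- Chevalley-Eilenberg differential of a 3-form. -/
def d3 (a : L → L → L → ℝ) (X Y Z W : L) : ℝ :=
  -a ⁅X, Y⁆ Z W + a ⁅X, Z⁆ Y W - a ⁅X, W⁆ Y Z
    - a ⁅Y, Z⁆ X W + a ⁅Y, W⁆ X Z - a ⁅Z, W⁆ X Y

end Forms

section Hermitian

variable {L : Type*} [LieRing L] [LieAlgebra ℝ L]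

/-- The `i`-th form of the coframe dual to the frame `e`, numbered from `0`. -/
noncomputable def cof (e : Module.Basis (Fin 6) ℝ L) (i : Fin 6) (X : L) : ℝ := e.coord i X

/-- The 2-form obtained as the wedge product of the `i`-th and `j`-th forms of the coframe. -/
noncomputable def cof2 (e : Module.Basis (Fin 6) ℝ L) (i j : Fin 6) : L → L → ℝ :=
  wedge11 (cof e i) (cof e j)

/-- The Lie algebra is isomorphic to `𝔥₅ = (0, 0, 0, 0, 13 + 42, 14 + 23)`. -/
def IsH5 (L : Type*) [LieRing L] [LieAlgebra ℝ L] : Prop :=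
  ∃ e : Module.Basis (Fin 6) ℝ L,
    (∀ i : Fin 6, i < 4 → d1 (cof e i) = 0) ∧
    d1 (cof e 4) = cof2 e 0 2 + cof2 e 3 1 ∧
    d1 (cof e 5) = cof2 e 0 3 + cof2 e 1 2

/-- A complex structure on a Lie algebra. -/
structure IsComplexStructure (J : L →ₗ[ℝ] L) : Prop where
  sq : ∀ X, J (J X) = -X
  nijenhuis : ∀ X Y, ⁅J X, J Y⁆ = J ⁅J X, Y⁆ + J ⁅X, J Y⁆ + ⁅X, Y⁆

/-- The abelian condition on a complex structure. -/
def IsAbelianStructure (J : L →ₗ[ℝ] L) : Prop := ∀ X Y, ⁅J X, J Y⁆ = ⁅X, Y⁆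

/-- `(J, g)` is a Hermitian structure on the Lie algebra. -/
structure IsHermitianStructure (J : L →ₗ[ℝ] L) (g : L →ₗ[ℝ] L →ₗ[ℝ] ℝ) : Prop where
  complex : IsComplexStructure J
  symm : ∀ X Y, g X Y = g Y X
  pos : ∀ X, X ≠ 0 → 0 < g X X
  compat : ∀ X Y, g (J X) (J Y) = g X Y

/-- The fundamental form `F(X, Y) = g(X, JY)`. -/
def fundForm (J : L →ₗ[ℝ] L) (g : L →ₗ[ℝ] L →ₗ[ℝ] ℝ) (X Y : L) : ℝ := g X (J Y)

/-- The balanced condition `F ∧ dF = 0`, i.e. `d(F²) = 0`. -/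
def IsBalanced (J : L →ₗ[ℝ] L) (g : L →ₗ[ℝ] L →ₗ[ℝ] ℝ) : Prop :=
  wedge23 (fundForm J g) (d2 (fundForm J g)) = 0

/-- The torsion 3-form `T = J dF`, i.e. `T(X, Y, Z) = -dF(JX, JY, JZ)`. -/
def torsionForm (J : L →ₗ[ℝ] L) (g : L →ₗ[ℝ] L →ₗ[ℝ] ℝ) (X Y Z : L) : ℝ :=
  -d2 (fundForm J g) (J X) (J Y) (J Z)

/-- The frame `e` is adapted to `(J, g)`: with the convention `(Ja)(X) = -a(JX)` on 1-forms,
`Je¹ = -e²`, `Je³ = -e⁴`, `Je⁵ = -e⁶` and `F = e¹² + e³⁴ + e⁵⁶`. -/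
structure IsAdapted (J : L →ₗ[ℝ] L) (g : L →ₗ[ℝ] L →ₗ[ℝ] ℝ)
    (e : Module.Basis (Fin 6) ℝ L) : Prop where
  J12 : ∀ X, -cof e 0 (J X) = -cof e 1 X
  J34 : ∀ X, -cof e 2 (J X) = -cof e 3 X
  J56 : ∀ X, -cof e 4 (J X) = -cof e 5 X
  fund : fundForm J g = cof2 e 0 1 + cof2 e 2 3 + cof2 e 4 5

/-- The (3,0)-form `Ψ = (e¹ + i e²) ∧ (e³ + i e⁴) ∧ (e⁵ + i e⁶)`. -/
noncomputable def volForm (e : Module.Basis (Fin 6) ℝ L) (X Y Z : L) : ℂ :=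
  let a : L → ℂ := fun V => cof e 0 V + Complex.I * cof e 1 V
  let b : L → ℂ := fun V => cof e 2 V + Complex.I * cof e 3 V
  let c : L → ℂ := fun V => cof e 4 V + Complex.I * cof e 5 V
  Matrix.det !![a X, a Y, a Z; b X, b Y, b Z; c X, c Y, c Z]

/-! The 2-forms `γ₁, γ₂, γ₃`. -/

/-- `γ₁ = e¹² - e³⁴`. -/
noncomputable def gamma1 (e : Module.Basis (Fin 6) ℝ L) : L → L → ℝ := cof2 e 0 1 - cof2 e 2 3
/-- `γ₂ = e¹³ + e²⁴`. -/
noncomputable def gamma2 (e : Module.Basis (Fin 6) ℝ L) : L → L → ℝ := cof2 e 0 2 + cof2 e 1 3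
/-- `γ₃ = e¹⁴ - e²³`. -/
noncomputable def gamma3 (e : Module.Basis (Fin 6) ℝ L) : L → L → ℝ := cof2 e 0 3 - cof2 e 1 2

/-- The structure equations of the first family (vanishing metric coefficient `u`), for abelian
complex structures on `𝔥₅`. -/
def StructureEquationsA (e : Module.Basis (Fin 6) ℝ L) : Prop :=
  (∀ i : Fin 6, i < 4 → d1 (cof e i) = 0) ∧
  ∃ s t : ℝ, s ≠ 0 ∧ t ≠ 0 ∧
    d1 (cof e 4) = (t / s) • gamma2 e ∧
    d1 (cof e 5) = (-2 * t) • gamma1 e - (t / s) • gamma3 e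

/-- The structure equations of the second family (non-zero metric coefficient `u = u₁ + i u₂`), for
abelian complex structures on `𝔥₅`. -/
def StructureEquationsB (e : Module.Basis (Fin 6) ℝ L) : Prop :=
  (∀ i : Fin 6, i < 4 → d1 (cof e i) = 0) ∧
  ∃ (s t Y : ℝ) (u : ℂ), t ≠ 0 ∧ 0 < ‖u‖ ^ 2 ∧ ‖u‖ ^ 2 < s ^ 2 ∧
    Y = 2 * √(s ^ 2 - ‖u‖ ^ 2) / (‖u‖ * t) ∧
    d1 (cof e 4) = (s * Y) • ((2 * u.re * ‖u‖) • gamma1 e - (t * u.re * ‖u‖ * Y) • gamma2 e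
      - (2 * s * u.im) • gamma3 e) ∧
    d1 (cof e 5) = (s * Y) • ((2 * (2 * s ^ 2 - u.im) * ‖u‖) • gamma1 e
      + (t * u.im * ‖u‖ * Y) • gamma2 e - (2 * s * u.re) • gamma3 e)

/-- The explicit adapted bases of balanced structures with abelian `J` on `𝔥₅`. -/
def IsStandardAdapted (J : L →ₗ[ℝ] L) (g : L →ₗ[ℝ] L →ₗ[ℝ] ℝ)
    (e : Module.Basis (Fin 6) ℝ L) : Prop :=
  IsAdapted J g e ∧ (StructureEquationsA e ∨ StructureEquationsB e)

end Hermitian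

section Connections

variable {L : Type*} [LieRing L] [LieAlgebra ℝ L]

/-! An invariant linear connection is a bilinear map `N X Y = ∇_X Y` on left-invariant fields. -/

/-- `∇g = 0`. -/
def PreservesMetric (g : L →ₗ[ℝ] L →ₗ[ℝ] ℝ) (N : L →ₗ[ℝ] L →ₗ[ℝ] L) : Prop :=
  ∀ X Y Z, g (N X Y) Z + g Y (N X Z) = 0

/-- `∇J = 0`. -/
def PreservesJ (J : L →ₗ[ℝ] L) (N : L →ₗ[ℝ] L →ₗ[ℝ] L) : Prop :=
  ∀ X Y, N X (J Y) = J (N X Y)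

/-- `∇Ψ = 0`. -/
def PreservesVolForm (Psi : L → L → L → ℂ) (N : L →ₗ[ℝ] L →ₗ[ℝ] L) : Prop :=
  ∀ X U V W, Psi (N X U) V W + Psi U (N X V) W + Psi U V (N X W) = 0

/-- The Bismut connection of `(J, g)`: the Hermitian connection whose torsion tensor `Tor`
satisfies `g(X, Tor(Y, Z)) = T(X, Y, Z)`. -/
structure IsBismut (J : L →ₗ[ℝ] L) (g : L →ₗ[ℝ] L →ₗ[ℝ] ℝ) (N : L →ₗ[ℝ] L →ₗ[ℝ] L) : Prop where
  metric : PreservesMetric g N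
  almostComplex : PreservesJ J N
  torsion : ∀ X Y Z, g X (N Y Z - N Z Y - ⁅Y, Z⁆) = torsionForm J g X Y Z

/-- The Bismut connection is unique. -/
theorem IsBismut.unique {J : L →ₗ[ℝ] L} {g : L →ₗ[ℝ] L →ₗ[ℝ] ℝ} (hg : IsHermitianStructure J g)
    {N N' : L →ₗ[ℝ] L →ₗ[ℝ] L} (h : IsBismut J g N) (h' : IsBismut J g N') : N = N' := by
  have sk : ∀ X Y Z, g (N X Y - N' X Y) Z = -g (N X Z - N' X Z) Y := by
    intro X Y Z
    have h1 := h.metric X Y Z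
    have h2 := h'.metric X Y Z
    have h3 := hg.symm Y (N X Z)
    have h4 := hg.symm Y (N' X Z)
    simp only [map_sub, LinearMap.sub_apply]
    linarith
  have sy : ∀ X Y Z, g (N X Y - N' X Y) Z = g (N Y X - N' Y X) Z := by
    intro X Y Z
    have h1 := h.torsion Z X Y
    have h2 := h'.torsion Z X Y
    rw [hg.symm] at h1 h2
    simp only [map_sub, LinearMap.sub_apply] at h1 h2 ⊢
    linarith
  have z : ∀ X Y Z, g (N X Y - N' X Y) Z = 0 := by
    intro X Y Z
    have e1 := sk X Y Z
    have e2 := sy X Z Y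
    have e3 := sk Z X Y
    have e4 := sy Z Y X
    have e5 := sk Y Z X
    have e6 := sy Y X Z
    linarith
  refine LinearMap.ext fun X => LinearMap.ext fun Y => ?_
  by_contra hne
  have hp := hg.pos _ (sub_ne_zero.mpr hne)
  rw [z] at hp
  exact lt_irrefl _ hp

/-- Connection 1-forms `σ^i_j` with respect to the frame `e`: `∇_X e_j = ∑ i, σ^i_j(X) e_i`. -/
noncomputable def connForm (e : Module.Basis (Fin 6) ℝ L) (N : L →ₗ[ℝ] L →ₗ[ℝ] L)
    (i j : Fin 6) (X : L) : ℝ := cof e i (N X (e j))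

/-- Curvature 2-forms `Ω^i_j = dσ^i_j + ∑ k, σ^i_k ∧ σ^k_j`. -/
noncomputable def curvForm (e : Module.Basis (Fin 6) ℝ L) (N : L →ₗ[ℝ] L →ₗ[ℝ] L)
    (i j : Fin 6) : L → L → ℝ :=
  d1 (connForm e N i j) + ∑ k, wedge11 (connForm e N i k) (connForm e N k j)

/-- The first Pontrjagin form `p₁ = (1 / 8π²) ∑_{i<j} Ω^i_j ∧ Ω^i_j`. -/
noncomputable def p1Form (e : Module.Basis (Fin 6) ℝ L) (N : L →ₗ[ℝ] L →ₗ[ℝ] L) :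
    L → L → L → L → ℝ :=
  (1 / (8 * Real.pi ^ 2)) •
    ∑ i : Fin 6, ∑ j ∈ Finset.Ioi i, wedge22 (curvForm e N i j) (curvForm e N i j)

/-- The connection `A_lam`, whose non-zero connection 1-forms with respect to `e` are
`σ^1_2 = -σ^2_1 = -σ^3_4 = σ^4_3 = lam (e⁵ + e⁶)`. -/
noncomputable def connA (e : Module.Basis (Fin 6) ℝ L) (lam : ℝ) : L →ₗ[ℝ] L →ₗ[ℝ] L :=
  (lam • (e.coord 4 + e.coord 5)).smulRight
    (Matrix.toLin e e !![0, 1, 0, 0, 0, 0;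
                        -1, 0, 0, 0, 0, 0;
                         0, 0, 0, -1, 0, 0;
                         0, 0, 1, 0, 0, 0;
                         0, 0, 0, 0, 0, 0;
                         0, 0, 0, 0, 0, 0])

/-- `A` is a non-flat (Donaldson-Uhlenbeck-Yau) instanton for the `SU(3)`-structure with adapted
frame `e`: an `SU(3)`-connection with curvature 2-forms in `𝔰𝔲(3)`. -/
structure IsSU3Instanton (J : L →ₗ[ℝ] L) (g : L →ₗ[ℝ] L →ₗ[ℝ] ℝ)
    (e : Module.Basis (Fin 6) ℝ L) (A : L →ₗ[ℝ] L →ₗ[ℝ] L) : Prop where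
  metric : PreservesMetric g A
  almostComplex : PreservesJ J A
  volForm : PreservesVolForm (volForm e) A
  primitive : ∀ i j, curvForm e A i j (e 0) (e 1) + curvForm e A i j (e 2) (e 3)
    + curvForm e A i j (e 4) (e 5) = 0
  type11 : ∀ i j X Y, curvForm e A i j (J X) (J Y) = curvForm e A i j X Y
  nonflat : ∃ i j, curvForm e A i j ≠ 0

end Connections

section Nilmanifold

variable {G : Type*} [TopologicalSpace G] [ChartedSpace (EuclideanSpace ℝ (Fin 6)) G] [Group G]

instance lieGroupMinSmoothness [LieGroup (𝓡 6) ∞ G] : LieGroup (𝓡 6) (minSmoothness ℝ 3) G := by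
  rw [minSmoothness_of_isRCLikeNormedField]
  infer_instance

/-- The Lie algebra of a six-dimensional Lie group. -/
abbrev LieAlg (G : Type*) [TopologicalSpace G] [ChartedSpace (EuclideanSpace ℝ (Fin 6)) G]
    [Group G] : Type _ := GroupLieAlgebra (𝓡 6) G

variable [LieGroup (𝓡 6) ∞ G]

/-- `tau` is the parallel transport, from time `0` to time `1`, of the invariant connection `N`
along the curve `c` in `G`, in the frame of left-invariant vector fields: if `xi` is the left
logarithmic derivative of `c`, a field `V` along `c` is parallel when `V' + ∇_xi V = 0`. -/
def IsParallelTransport (N : LieAlg G →ₗ[ℝ] LieAlg G →ₗ[ℝ] LieAlg G) (c : ℝ → G)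
    (tau : LieAlg G →ₗ[ℝ] LieAlg G) : Prop :=
  ∀ v : LieAlg G, ∃ V : ℝ → LieAlg G, V 0 = v ∧ V 1 = tau v ∧
    ∀ t ∈ Set.Icc (0 : ℝ) 1, ∃ xi : LieAlg G,
      mfderiv 𝓘(ℝ, ℝ) (𝓡 6) c t (1 : ℝ) = mulInvariantVectorField xi (c t) ∧
      HasDerivWithinAt V (-(N xi (V t))) (Set.Icc 0 1) t

/-- The holonomy group, at the point `Γ x` of `M = Γ \ G`, of the invariant connection `N`: parallel
transports along the loops of `M` at `Γ x`, i.e. along the images of curves in `G` from `x` to some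
`γ x` with `γ ∈ Γ`. -/
def holonomy (Γ : Subgroup G) (N : LieAlg G →ₗ[ℝ] LieAlg G →ₗ[ℝ] LieAlg G) (x : G) :
    Set (LieAlg G →ₗ[ℝ] LieAlg G) :=
  {tau | ∃ c : ℝ → G, ContMDiff 𝓘(ℝ, ℝ) (𝓡 6) 1 c ∧ c 0 = x ∧ (∃ γ ∈ Γ, c 1 = γ * x) ∧
    IsParallelTransport N c tau}

/-- The group `SU(3)`, as the stabilizer of `(J, g, Ψ)`. -/
def stabSU3 {L : Type*} [AddCommGroup L] [Module ℝ L] (J : L →ₗ[ℝ] L) (g : L →ₗ[ℝ] L →ₗ[ℝ] ℝ)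
    (Psi : L → L → L → ℂ) : Set (L →ₗ[ℝ] L) :=
  {tau | (∀ X, tau (J X) = J (tau X)) ∧ (∀ X Y, g (tau X) (tau Y) = g X Y) ∧
    ∀ X Y Z, Psi (tau X) (tau Y) (tau Z) = Psi X Y Z}

/-- The invariant Hermitian `SU(3)`-structure `(J, g, Ψ)` with adapted frame `e` on `Γ \ G`, with
Bismut connection `N`, and the invariant instanton `A` solve the Strominger system with constant
dilaton, with `N` in the anomaly cancellation condition. -/
structure SolvesStrominger (Γ : Subgroup G) (J : LieAlg G →ₗ[ℝ] LieAlg G)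
    (g : LieAlg G →ₗ[ℝ] LieAlg G →ₗ[ℝ] ℝ) (e : Module.Basis (Fin 6) ℝ (LieAlg G))
    (N A : LieAlg G →ₗ[ℝ] LieAlg G →ₗ[ℝ] LieAlg G) (alpha : ℝ) : Prop where
  hermitian : IsHermitianStructure J g
  adapted : IsAdapted J g e
  bismut : IsBismut J g N
  gravitino : ∀ x : G, holonomy Γ N x ⊆ stabSU3 J g (volForm e)
  dilatino : IsBalanced J g
  gaugino : IsSU3Instanton J g e A
  alpha_pos : 0 < alpha
  anomaly : d3 (torsionForm J g) = (2 * Real.pi ^ 2 * alpha) • (p1Form e N - p1Form e A)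

end Nilmanifold

/-! On `𝔥₅` with abelian `J` the centre is the commutator ideal and a complex line. A unitary frame
whose last complex vector spans it has e¹, …, e⁴ closed, while de⁵ and de⁶ are forms on the
complementary complex plane. Abelian `J` makes these two of type (1,1), and the balanced condition
kills their trace. Hence they are anti-self-dual, and the whole geometry is encoded by two vectors
v, w in ℝ³, their coordinates in γ₁, γ₂, γ₃ (`exists_hasASDEquations`).

The same ℝ³ is a copy of 𝔰𝔲(2) acting on the first two complex directions, with commutator twice the
cross product. The Bismut connection is -v ⊗ e⁵ - w ⊗ e⁶ (`IsAdapted.isBismut`), so it takes values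
in 𝔰𝔲(3), and integrating along curves puts its holonomy in SU(3). For a connection a ⊗ e⁵ + b ⊗ e⁶,
p₁ is a multiple of e¹²³⁴ with a coefficient quadratic in a, b (`p1Form_asdConnection`), because the
commutator is orthogonal to a and b. As dT = -2(|v|² + |w|²) e¹²³⁴, the anomaly equation is one
scalar equation for α', solvable with α' > 0 as soon as λ²|v + w|² < |v|⁴ + |w|⁴ + 2(v·w)². The
curvature of `connA` is proportional to v + w, nonzero because v and w are independent.

For the explicit bases, unitary changes of frame act on (v, w) by SO(3) on both vectors and by a
rotation mixing them. One may thus take v ⊥ w with |v| ≤ |w|; only the two norms then matter. Strict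
inequality gives family A, and equality is realized in family B. -/

open scoped Matrix

/-! ### Anti-self-dual forms, 𝔰𝔲(2)-valued connections and their Pontrjagin forms. -/

section ASD

/-- The matrix of coefficients of `asdForm e v`. -/
def asdMatrix (v : Fin 3 → ℝ) : Matrix (Fin 6) (Fin 6) ℝ :=
  !![0, v 0, v 1, v 2, 0, 0;
     -v 0, 0, -v 2, v 1, 0, 0;
     -v 1, v 2, 0, -v 0, 0, 0;
     -v 2, -v 1, v 0, 0, 0, 0;
     0, 0, 0, 0, 0, 0;
     0, 0, 0, 0, 0, 0]

/-- The commutator of two matrices `asdMatrix` is twice the matrix of the cross product. -/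
theorem asdMatrix_commutator (a b : Fin 3 → ℝ) :
    asdMatrix a * asdMatrix b - asdMatrix b * asdMatrix a =
      asdMatrix ((2 : ℝ) • crossProduct a b) := by
  ext i j
  rw [Matrix.sub_apply, Matrix.mul_apply, Matrix.mul_apply, Fin.sum_univ_six, Fin.sum_univ_six]
  fin_cases i <;> fin_cases j <;> simp [asdMatrix, cross_apply] <;> ring

theorem wedge22_combination_self {M : Type*} (p q r : ℝ) (a b c : M → M → ℝ) :
    wedge22 (p • a + q • b + r • c) (p • a + q • b + r • c) =
      p ^ 2 • wedge22 a a + q ^ 2 • wedge22 b b + r ^ 2 • wedge22 c c + (2 * p * q) • wedge22 a b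
        + (2 * p * r) • wedge22 a c + (2 * q * r) • wedge22 b c := by
  funext X Y Z W
  simp only [wedge22, Pi.add_apply, Pi.smul_apply, smul_eq_mul]
  ring

/-- Each coordinate occupies two entries above the diagonal, up to sign. This turns the sum over i <
j in p₁ into an inner product on ℝ³. -/
theorem sum_asdMatrix (a b : Fin 3 → ℝ) :
    ∑ i : Fin 6, ∑ j ∈ Finset.Ioi i, asdMatrix a i j * asdMatrix b i j = 2 * (a ⬝ᵥ b) := by
  have h : ∀ i : Fin 6, ∑ j ∈ Finset.Ioi i, asdMatrix a i j * asdMatrix b i j =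
      ∑ j, if i < j then asdMatrix a i j * asdMatrix b i j else 0 := fun i => by
    rw [← Finset.sum_filter]
    exact Finset.sum_congr (by ext; simp) fun _ _ => rfl
  simp only [h, Fin.sum_univ_six]
  simp [asdMatrix, dotProduct, Fin.sum_univ_three]
  ring

variable {L : Type*} [LieRing L] [LieAlgebra ℝ L]

/-- The anti-self-dual 2-form `v₀ γ₁ + v₁ γ₂ + v₂ γ₃`. -/
noncomputable def asdForm (e : Module.Basis (Fin 6) ℝ L) (v : Fin 3 → ℝ) : L → L → ℝ :=
  v 0 • gamma1 e + v 1 • gamma2 e + v 2 • gamma3 e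

/-- The structure equations with `de¹ = … = de⁴ = 0` and `de⁵`, `de⁶` anti-self-dual. -/
structure HasASDEquations (e : Module.Basis (Fin 6) ℝ L) (v w : Fin 3 → ℝ) : Prop where
  closed : ∀ i : Fin 6, i < 4 → d1 (cof e i) = 0
  d5 : d1 (cof e 4) = asdForm e v
  d6 : d1 (cof e 5) = asdForm e w

/-- The invariant connection with connection matrix `a ⊗ e⁵ + b ⊗ e⁶`, where `a` and `b` are
regarded as matrices through `asdMatrix`. -/
noncomputable def asdConnection (e : Module.Basis (Fin 6) ℝ L) (a b : Fin 3 → ℝ) :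
    L →ₗ[ℝ] L →ₗ[ℝ] L :=
  (e.coord 4).smulRight (Matrix.toLin e e (asdMatrix a)) +
    (e.coord 5).smulRight (Matrix.toLin e e (asdMatrix b))

theorem cof_add (e : Module.Basis (Fin 6) ℝ L) (i : Fin 6) (X Y : L) :
    cof e i (X + Y) = cof e i X + cof e i Y := by simp [cof]

theorem cof_sub (e : Module.Basis (Fin 6) ℝ L) (i : Fin 6) (X Y : L) :
    cof e i (X - Y) = cof e i X - cof e i Y := by simp [cof]

theorem cof_neg (e : Module.Basis (Fin 6) ℝ L) (i : Fin 6) (X : L) :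
    cof e i (-X) = -cof e i X := by simp [cof]

theorem cof_smul (e : Module.Basis (Fin 6) ℝ L) (i : Fin 6) (c : ℝ) (X : L) :
    cof e i (c • X) = c * cof e i X := by simp [cof]

theorem cof_basis (e : Module.Basis (Fin 6) ℝ L) (i j : Fin 6) :
    cof e i (e j) = if i = j then 1 else 0 := by
  simp [cof, Finsupp.single_apply, eq_comm]

theorem ext_cof (e : Module.Basis (Fin 6) ℝ L) {X Y : L} (h : ∀ i, cof e i X = cof e i Y) :
    X = Y := e.ext_elem h

theorem cof_toLin (e : Module.Basis (Fin 6) ℝ L) (M : Matrix (Fin 6) (Fin 6) ℝ) (i : Fin 6)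
    (X : L) : cof e i (Matrix.toLin e e M X) = ∑ j, M i j * cof e j X := by
  simp only [cof, Module.Basis.coord_apply]
  rw [← LinearMap.toMatrix_mulVec_repr e e, LinearMap.toMatrix_toLin]
  rfl

theorem cof_asdConnection (e : Module.Basis (Fin 6) ℝ L) (a b : Fin 3 → ℝ) (i : Fin 6) (X Y : L) :
    cof e i (asdConnection e a b X Y) =
      ∑ j, (cof e 4 X * asdMatrix a i j + cof e 5 X * asdMatrix b i j) * cof e j Y := by
  simp only [asdConnection, LinearMap.add_apply, LinearMap.smulRight_apply, LinearMap.smul_apply,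
    cof_add, cof_smul, cof_toLin, Finset.mul_sum, ← Finset.sum_add_distrib]
  refine Finset.sum_congr rfl fun j _ => ?_
  simp only [cof]; ring

theorem connA_eq_asdConnection (e : Module.Basis (Fin 6) ℝ L) (lam : ℝ) :
    connA e lam = asdConnection e ![lam, 0, 0] ![lam, 0, 0] := by
  have hM : ∀ i j : Fin 6, lam * (!![0, 1, 0, 0, 0, 0; -1, 0, 0, 0, 0, 0; 0, 0, 0, -1, 0, 0;
      0, 0, 1, 0, 0, 0; 0, 0, 0, 0, 0, 0; 0, 0, 0, 0, 0, 0] : Matrix (Fin 6) (Fin 6) ℝ) i j =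
      asdMatrix ![lam, 0, 0] i j := by
    intro i j
    fin_cases i <;> fin_cases j <;> simp [asdMatrix]
  refine LinearMap.ext fun X => LinearMap.ext fun Y => ext_cof e fun i => ?_
  rw [cof_asdConnection]
  simp only [connA, LinearMap.smulRight_apply, LinearMap.smul_apply, cof_smul, cof_toLin,
    Finset.mul_sum]
  refine Finset.sum_congr rfl fun j _ => ?_
  rw [← hM]
  simp only [cof, LinearMap.add_apply, smul_eq_mul]
  ring

theorem asdForm_apply (e : Module.Basis (Fin 6) ℝ L) (v : Fin 3 → ℝ) (X Y : L) :
    asdForm e v X Y =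
      v 0 * (cof e 0 X * cof e 1 Y - cof e 1 X * cof e 0 Y
        - (cof e 2 X * cof e 3 Y - cof e 3 X * cof e 2 Y))
      + v 1 * (cof e 0 X * cof e 2 Y - cof e 2 X * cof e 0 Y
        + (cof e 1 X * cof e 3 Y - cof e 3 X * cof e 1 Y))
      + v 2 * (cof e 0 X * cof e 3 Y - cof e 3 X * cof e 0 Y
        - (cof e 1 X * cof e 2 Y - cof e 2 X * cof e 1 Y)) := by
  simp [asdForm, gamma1, gamma2, gamma3, cof2, wedge11]
  ring

theorem HasASDEquations.cof_bracket {e : Module.Basis (Fin 6) ℝ L} {v w : Fin 3 → ℝ}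
    (h : HasASDEquations e v w) (X Y : L) :
    cof e 0 ⁅X, Y⁆ = 0 ∧ cof e 1 ⁅X, Y⁆ = 0 ∧ cof e 2 ⁅X, Y⁆ = 0 ∧ cof e 3 ⁅X, Y⁆ = 0 ∧
      cof e 4 ⁅X, Y⁆ = -asdForm e v X Y ∧ cof e 5 ⁅X, Y⁆ = -asdForm e w X Y := by
  have c : ∀ i : Fin 6, i < 4 → cof e i ⁅X, Y⁆ = 0 := fun i hi => by
    have := congrFun (congrFun (h.closed i hi) X) Y
    simpa [d1] using this
  refine ⟨c 0 (by decide), c 1 (by decide), c 2 (by decide), c 3 (by decide), ?_, ?_⟩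
  · rw [← h.d5]; simp [d1]
  · rw [← h.d6]; simp [d1]

theorem connForm_asdConnection (e : Module.Basis (Fin 6) ℝ L) (a b : Fin 3 → ℝ) (i j : Fin 6) :
    connForm e (asdConnection e a b) i j =
      asdMatrix a i j • cof e 4 + asdMatrix b i j • cof e 5 := by
  funext X
  simp only [connForm, cof_asdConnection, cof_basis]
  simp [mul_comm]

/-- The forms e⁵, e⁶ contribute their differentials, and the quadratic term of the curvature leaves
only the commutator on e⁵⁶. -/
theorem curvForm_asdConnection {e : Module.Basis (Fin 6) ℝ L} {v w : Fin 3 → ℝ}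
    (h : HasASDEquations e v w) (a b : Fin 3 → ℝ) (i j : Fin 6) :
    curvForm e (asdConnection e a b) i j =
      asdMatrix a i j • asdForm e v + asdMatrix b i j • asdForm e w +
        (asdMatrix a * asdMatrix b - asdMatrix b * asdMatrix a) i j • cof2 e 4 5 := by
  funext X Y
  obtain ⟨-, -, -, -, h4, h5⟩ := h.cof_bracket X Y
  simp only [curvForm, connForm_asdConnection, d1, Pi.add_apply, Pi.smul_apply, smul_eq_mul, h4, h5,
    Finset.sum_apply, Matrix.sub_apply, Matrix.mul_apply, ← Finset.sum_sub_distrib, Finset.sum_mul,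
    wedge11, cof2]
  refine congrArg₂ (· + ·) (by ring) (Finset.sum_congr rfl fun k _ => by ring)

/-- γᵢ ∧ γⱼ = -2 δᵢⱼ e¹²³⁴. -/
theorem wedge22_asdForm (e : Module.Basis (Fin 6) ℝ L) (v w : Fin 3 → ℝ) :
    wedge22 (asdForm e v) (asdForm e w) = (-2 * (v ⬝ᵥ w)) • wedge22 (cof2 e 0 1) (cof2 e 2 3) := by
  funext X Y Z W
  simp only [wedge22, Pi.smul_apply, smul_eq_mul, asdForm_apply, cof2, wedge11, dotProduct,
    Fin.sum_univ_three]
  ring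

theorem wedge22_cof2_self (e : Module.Basis (Fin 6) ℝ L) (i j : Fin 6) :
    wedge22 (cof2 e i j) (cof2 e i j) = 0 := by
  funext X Y Z W
  simp only [wedge22, cof2, wedge11, Pi.zero_apply]
  ring

theorem p1Form_asdConnection {e : Module.Basis (Fin 6) ℝ L} {v w : Fin 3 → ℝ}
    (h : HasASDEquations e v w) (a b : Fin 3 → ℝ) :
    p1Form e (asdConnection e a b) =
      (-(1 / (2 * Real.pi ^ 2)) * ((a ⬝ᵥ a) * (v ⬝ᵥ v) + (b ⬝ᵥ b) * (w ⬝ᵥ w)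
        + 2 * (a ⬝ᵥ b) * (v ⬝ᵥ w))) • wedge22 (cof2 e 0 1) (cof2 e 2 3) := by
  -- The mixed terms of Ω ∧ Ω containing e⁵⁶ carry these triple products, so they vanish; its square
  -- vanishes since e⁵⁶ ∧ e⁵⁶ = 0.
  have ha : a ⬝ᵥ ((2 : ℝ) • crossProduct a b) = 0 := by simp
  have hb : b ⬝ᵥ ((2 : ℝ) • crossProduct a b) = 0 := by simp
  have key : ∑ i : Fin 6, ∑ j ∈ Finset.Ioi i, wedge22 (curvForm e (asdConnection e a b) i j)
      (curvForm e (asdConnection e a b) i j) = (2 * (a ⬝ᵥ a)) • wedge22 (asdForm e v) (asdForm e v)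
      + (2 * (b ⬝ᵥ b)) • wedge22 (asdForm e w) (asdForm e w)
      + (2 * (2 * (a ⬝ᵥ b))) • wedge22 (asdForm e v) (asdForm e w) := by
    have hs : ∀ (c d : Fin 3 → ℝ) (k : ℝ) (F : L → L → L → L → ℝ),
        ∑ i : Fin 6, ∑ j ∈ Finset.Ioi i, (k * (asdMatrix c i j * asdMatrix d i j)) • F =
          (k * (2 * (c ⬝ᵥ d))) • F := fun c d k F => by
      simp only [← Finset.sum_smul, ← Finset.mul_sum, sum_asdMatrix]
    simp only [curvForm_asdConnection h, asdMatrix_commutator, wedge22_combination_self,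
      wedge22_cof2_self, smul_zero, add_zero, Finset.sum_add_distrib, pow_two, mul_assoc]
    have hs1 : ∀ (c d : Fin 3 → ℝ) (F : L → L → L → L → ℝ),
        ∑ i : Fin 6, ∑ j ∈ Finset.Ioi i, (asdMatrix c i j * asdMatrix d i j) • F =
          (2 * (c ⬝ᵥ d)) • F := fun c d F => by
      simpa using hs c d 1 F
    simp only [hs, hs1, ha, hb, mul_zero, zero_smul, add_zero]
  rw [p1Form, key, wedge22_asdForm, wedge22_asdForm, wedge22_asdForm]
  simp only [smul_smul, ← add_smul]
  congr 1
  field_simp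
  ring

end ASD

/-! ### Torsion, Bismut connection, instanton and anomaly in an adapted frame. -/

section Adapted

variable {L : Type*} [LieRing L] [LieAlgebra ℝ L]
  {J : L →ₗ[ℝ] L} {g : L →ₗ[ℝ] L →ₗ[ℝ] ℝ} {e : Module.Basis (Fin 6) ℝ L} {v w : Fin 3 → ℝ}

theorem IsAdapted.cof_J (he : IsAdapted J g e) (hJ : IsComplexStructure J) (X : L) :
    cof e 0 (J X) = cof e 1 X ∧ cof e 1 (J X) = -cof e 0 X ∧
    cof e 2 (J X) = cof e 3 X ∧ cof e 3 (J X) = -cof e 2 X ∧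
    cof e 4 (J X) = cof e 5 X ∧ cof e 5 (J X) = -cof e 4 X := by
  have h1 := neg_injective (he.J12 X)
  have h2 := neg_injective (he.J12 (J X))
  have h3 := neg_injective (he.J34 X)
  have h4 := neg_injective (he.J34 (J X))
  have h5 := neg_injective (he.J56 X)
  have h6 := neg_injective (he.J56 (J X))
  rw [hJ.sq, cof_neg] at h2 h4 h6
  exact ⟨h1, h2.symm, h3, h4.symm, h5, h6.symm⟩

theorem IsAdapted.metric_eq (he : IsAdapted J g e) (hJ : IsComplexStructure J) (X Y : L) :
    g X Y = ∑ i, cof e i X * cof e i Y := by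
  have h : g X (J (J Y)) = _ := congrFun (congrFun he.fund X) (J Y)
  obtain ⟨h0, h1, h2, h3, h4, h5⟩ := he.cof_J hJ Y
  simp only [Pi.add_apply, cof2, wedge11, h0, h1, h2, h3, h4, h5] at h
  rw [hJ.sq, map_neg] at h
  rw [Fin.sum_univ_six]
  linarith

/-- T = de⁵ ∧ e⁵ + de⁶ ∧ e⁶, because anti-self-dual forms are `J`-invariant. -/
theorem IsAdapted.torsionForm_eq (he : IsAdapted J g e) (hJ : IsComplexStructure J)
    (h : HasASDEquations e v w) (X Y Z : L) :
    torsionForm J g X Y Z =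
      asdForm e v X Y * cof e 4 Z - asdForm e v X Z * cof e 4 Y + asdForm e v Y Z * cof e 4 X
      + asdForm e w X Y * cof e 5 Z - asdForm e w X Z * cof e 5 Y
      + asdForm e w Y Z * cof e 5 X := by
  obtain ⟨x0, x1, x2, x3, x4, x5⟩ := he.cof_J hJ X
  obtain ⟨y0, y1, y2, y3, y4, y5⟩ := he.cof_J hJ Y
  obtain ⟨z0, z1, z2, z3, z4, z5⟩ := he.cof_J hJ Z
  obtain ⟨a0, a1, a2, a3, a4, a5⟩ := h.cof_bracket (J X) (J Y)
  obtain ⟨b0, b1, b2, b3, b4, b5⟩ := h.cof_bracket (J X) (J Z)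
  obtain ⟨c0, c1, c2, c3, c4, c5⟩ := h.cof_bracket (J Y) (J Z)
  simp only [torsionForm, d2, he.fund, Pi.add_apply, cof2, wedge11, a0, a1, a2, a3, a4, a5, b0, b1,
    b2, b3, b4, b5, c0, c1, c2, c3, c4, c5, x0, x1, x2, x3, x4, x5, y0, y1, y2, y3, y4, y5, z0, z1,
    z2, z3, z4, z5, asdForm_apply]
  ring

theorem HasASDEquations.asdForm_bracket (h : HasASDEquations e v w) (u : Fin 3 → ℝ) (X Y Z : L) :
    asdForm e u ⁅X, Y⁆ Z = 0 := by
  obtain ⟨a0, a1, a2, a3, -, -⟩ := h.cof_bracket X Y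
  simp only [asdForm_apply, a0, a1, a2, a3]
  ring

theorem IsAdapted.d3_torsionForm (he : IsAdapted J g e) (hJ : IsComplexStructure J)
    (h : HasASDEquations e v w) :
    d3 (torsionForm J g) = (-2 * (v ⬝ᵥ v + w ⬝ᵥ w)) • wedge22 (cof2 e 0 1) (cof2 e 2 3) := by
  have hb : ∀ X Y, cof e 4 ⁅X, Y⁆ = -asdForm e v X Y ∧ cof e 5 ⁅X, Y⁆ = -asdForm e w X Y :=
    fun X Y => ⟨(h.cof_bracket X Y).2.2.2.2.1, (h.cof_bracket X Y).2.2.2.2.2⟩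
  rw [mul_add, add_smul, ← wedge22_asdForm, ← wedge22_asdForm]
  funext X Y Z W
  simp only [d3, he.torsionForm_eq hJ h, h.asdForm_bracket, (hb _ _).1, (hb _ _).2, wedge22,
    Pi.add_apply]
  ring

theorem IsAdapted.preservesMetric (he : IsAdapted J g e) (hJ : IsComplexStructure J)
    (a b : Fin 3 → ℝ) : PreservesMetric g (asdConnection e a b) := by
  intro X Y Z
  simp only [he.metric_eq hJ, cof_asdConnection, Fin.sum_univ_six]
  simp [asdMatrix]
  ring

theorem IsAdapted.preservesJ (he : IsAdapted J g e) (hJ : IsComplexStructure J)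
    (a b : Fin 3 → ℝ) : PreservesJ J (asdConnection e a b) := by
  intro X Y
  obtain ⟨y0, y1, y2, y3, y4, y5⟩ := he.cof_J hJ Y
  obtain ⟨z0, z1, z2, z3, z4, z5⟩ := he.cof_J hJ (asdConnection e a b X Y)
  refine ext_cof e fun i => ?_
  fin_cases i <;>
    simp [z0, z1, z2, z3, z4, z5, cof_asdConnection, y0, y1, y2, y3, y4, y5, Fin.sum_univ_six,
      asdMatrix] <;> ring

/-- In the complex coordinates of the frame the connection acts by a trace-free complex matrix,
which annihilates the determinant defining Ψ. -/
theorem preservesVolForm_asdConnection (e : Module.Basis (Fin 6) ℝ L) (a b : Fin 3 → ℝ) :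
    PreservesVolForm (volForm e) (asdConnection e a b) := by
  have hA : ∀ X Y, (cof e 0 (asdConnection e a b X Y) : ℂ)
        + Complex.I * cof e 1 (asdConnection e a b X Y) =
      -Complex.I * (cof e 4 X * a 0 + cof e 5 X * b 0) * (cof e 0 Y + Complex.I * cof e 1 Y)
      + ((cof e 4 X * a 1 + cof e 5 X * b 1) - Complex.I * (cof e 4 X * a 2 + cof e 5 X * b 2))
        * (cof e 2 Y + Complex.I * cof e 3 Y) ∧
      (cof e 2 (asdConnection e a b X Y) : ℂ)
        + Complex.I * cof e 3 (asdConnection e a b X Y) =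
      Complex.I * (cof e 4 X * a 0 + cof e 5 X * b 0) * (cof e 2 Y + Complex.I * cof e 3 Y)
      + (-(cof e 4 X * a 1 + cof e 5 X * b 1) - Complex.I * (cof e 4 X * a 2 + cof e 5 X * b 2))
        * (cof e 0 Y + Complex.I * cof e 1 Y) ∧
      (cof e 4 (asdConnection e a b X Y) : ℂ)
        + Complex.I * cof e 5 (asdConnection e a b X Y) = 0 := by
    intro X Y
    simp only [cof_asdConnection, Fin.sum_univ_six]
    refine ⟨?_, ?_, ?_⟩ <;>
    · apply Complex.ext <;> simp [asdMatrix] <;> ring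
  intro X U V W
  simp only [volForm, hA, Matrix.det_fin_three, Matrix.of_apply, Matrix.cons_val_zero,
    Matrix.cons_val_one, Matrix.cons_val]
  ring

/-- Of the three cyclic terms in each de^k ∧ e^k of T, the connection matrices supply two and the
bracket the third. -/
theorem IsAdapted.isBismut (he : IsAdapted J g e) (hJ : IsComplexStructure J)
    (h : HasASDEquations e v w) : IsBismut J g (asdConnection e (-v) (-w)) where
  metric := he.preservesMetric hJ _ _
  almostComplex := he.preservesJ hJ _ _
  torsion X Y Z := by
    obtain ⟨a0, a1, a2, a3, a4, a5⟩ := h.cof_bracket Y Z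
    rw [he.torsionForm_eq hJ h, he.metric_eq hJ]
    simp only [cof_sub, cof_asdConnection, Fin.sum_univ_six, a0, a1, a2, a3, a4, a5, asdForm_apply]
    simp [asdMatrix]
    ring

/-- The two matrices of `connA` coincide, so the commutator drops out and the curvature is a
constant matrix times one anti-self-dual form, which is primitive of type (1,1). -/
theorem IsAdapted.isSU3Instanton (he : IsAdapted J g e) (hJ : IsComplexStructure J)
    (h : HasASDEquations e v w) (hvw : v + w ≠ 0) {lam : ℝ} (hl : lam ≠ 0) :
    IsSU3Instanton J g e (connA e lam) := by
  have hc : ∀ i j, curvForm e (connA e lam) i j =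
      asdMatrix ![lam, 0, 0] i j • asdForm e (v + w) := fun i j => by
    rw [connA_eq_asdConnection, curvForm_asdConnection h, sub_self]
    funext X Y
    simp only [Matrix.zero_apply, zero_smul, Pi.zero_apply, Pi.add_apply, Pi.smul_apply,
      smul_eq_mul, asdForm_apply]
    ring
  refine ⟨?_, ?_, ?_, ?_, ?_, ?_⟩
  · exact connA_eq_asdConnection e lam ▸ he.preservesMetric hJ _ _
  · exact connA_eq_asdConnection e lam ▸ he.preservesJ hJ _ _
  · exact connA_eq_asdConnection e lam ▸ preservesVolForm_asdConnection e _ _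
  · intro i j
    simp only [hc, Pi.smul_apply, asdForm_apply, cof_basis]
    simp
    ring
  · intro i j X Y
    obtain ⟨x0, x1, x2, x3, x4, x5⟩ := he.cof_J hJ X
    obtain ⟨y0, y1, y2, y3, y4, y5⟩ := he.cof_J hJ Y
    simp only [hc, Pi.smul_apply, asdForm_apply, x0, x1, x2, x3, y0, y1, y2, y3, smul_eq_mul]
    ring
  · refine ⟨0, 1, fun h0 => hvw ?_⟩
    have hz : asdForm e (v + w) = 0 := by
      have : asdMatrix ![lam, 0, 0] 0 1 = lam := by simp [asdMatrix]
      rw [hc, this] at h0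
      exact (smul_eq_zero.mp h0).resolve_left hl
    have h1 := congrFun (congrFun hz (e 0)) (e 1)
    have h2 := congrFun (congrFun hz (e 0)) (e 2)
    have h3 := congrFun (congrFun hz (e 0)) (e 3)
    simp only [asdForm_apply, cof_basis] at h1 h2 h3
    funext i
    fin_cases i
    · simpa using h1
    · simpa using h2
    · simpa using h3

theorem dotProduct_self_nonneg' (v : Fin 3 → ℝ) : 0 ≤ v ⬝ᵥ v :=
  Finset.sum_nonneg fun i _ => mul_self_nonneg (v i)

/-- Anomaly cancellation for small parameters. -/
theorem IsAdapted.exists_anomaly (he : IsAdapted J g e) (hJ : IsComplexStructure J)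
    (h : HasASDEquations e v w) (hvw : v + w ≠ 0) :
    ∃ lam₀ : ℝ, 0 < lam₀ ∧ ∀ lam : ℝ, |lam| < lam₀ → ∃ alpha : ℝ, 0 < alpha ∧
      d3 (torsionForm J g) = (2 * Real.pi ^ 2 * alpha) •
        (p1Form e (asdConnection e (-v) (-w)) - p1Form e (connA e lam)) := by
  have hv := dotProduct_self_nonneg' v
  have hw := dotProduct_self_nonneg' w
  have hs : (v + w) ⬝ᵥ (v + w) = v ⬝ᵥ v + w ⬝ᵥ w + 2 * (v ⬝ᵥ w) := by
    simp only [add_dotProduct, dotProduct_add, dotProduct_comm w v]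
    ring
  have hvw' : 0 < (v + w) ⬝ᵥ (v + w) :=
    lt_of_le_of_ne (dotProduct_self_nonneg' _) fun h0 => hvw (dotProduct_self_eq_zero.mp h0.symm)
  -- Parallelogram law: |v - w|² ≥ 0 and |v + w|² > 0.
  have ha : 0 < v ⬝ᵥ v + w ⬝ᵥ w := by
    have h1 := dotProduct_self_nonneg' (v - w)
    simp only [sub_dotProduct, dotProduct_sub, dotProduct_comm w v] at h1
    linarith
  set Q := (v ⬝ᵥ v) ^ 2 + (w ⬝ᵥ w) ^ 2 + 2 * (v ⬝ᵥ w) ^ 2 with hQ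
  have hQ0 : 0 < Q := by nlinarith [sq_nonneg (v ⬝ᵥ v - w ⬝ᵥ w), sq_nonneg (v ⬝ᵥ w)]
  refine ⟨√(Q / ((v + w) ⬝ᵥ (v + w))), Real.sqrt_pos.mpr (div_pos hQ0 hvw'), fun lam hlam => ?_⟩
  have hl : 0 < Q - lam ^ 2 * ((v + w) ⬝ᵥ (v + w)) := by
    rw [Real.lt_sqrt (abs_nonneg _), sq_abs, lt_div_iff₀ hvw'] at hlam
    linarith
  -- This α' is the solution of the scalar equation left after comparing the coefficients of e¹²³⁴.
  refine ⟨2 * (v ⬝ᵥ v + w ⬝ᵥ w) / (Q - lam ^ 2 * ((v + w) ⬝ᵥ (v + w))), by positivity, ?_⟩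
  have h3 : (![lam, 0, 0] : Fin 3 → ℝ) ⬝ᵥ ![lam, 0, 0] = lam ^ 2 := by
    simp [dotProduct, Fin.sum_univ_three, pow_two]
  rw [he.d3_torsionForm hJ h, connA_eq_asdConnection, p1Form_asdConnection h,
    p1Form_asdConnection h, h3, ← sub_smul, smul_smul]
  congr 1
  simp only [neg_dotProduct, dotProduct_neg, neg_neg]
  rw [hs] at hl ⊢
  rw [hQ] at hl ⊢
  field_simp
  ring

end Adapted

/-! ### Parallel tensors and the holonomy of an invariant connection. -/

section Holonomy

theorem LinearMap.hasDerivWithinAt_comp {E : Type*} [NormedAddCommGroup E] [NormedSpace ℝ E]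
    [FiniteDimensional ℝ E] (φ : E →ₗ[ℝ] ℝ) {V : ℝ → E} {V' : E} {s : Set ℝ} {t : ℝ}
    (h : HasDerivWithinAt V V' s t) : HasDerivWithinAt (fun r => φ (V r)) (φ V') s t :=
  (LinearMap.toContinuousLinearMap φ).hasFDerivAt.comp_hasDerivWithinAt t h

variable {G : Type*} [TopologicalSpace G] [ChartedSpace (EuclideanSpace ℝ (Fin 6)) G] [Group G]
  [LieGroup (𝓡 6) ∞ G]

theorem mulInvariantVectorField_injective (x : G) :
    Function.Injective fun xi : LieAlg G => mulInvariantVectorField (I := 𝓡 6) xi x := by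
  have M : minSmoothness ℝ 3 ≠ 0 := lt_of_lt_of_le (by simp) le_minSmoothness |>.ne'
  have hd : ∀ a b : G, MDifferentiableAt (𝓡 6) (𝓡 6) (fun y : G => a * y) b := fun a b =>
    (contMDiff_mul_left (I := 𝓡 6) (n := minSmoothness ℝ 3)).contMDiffAt.mdifferentiableAt M
  have A : mfderiv (𝓡 6) (𝓡 6) ((fun y : G => x⁻¹ * y) ∘ (fun y => x * y)) (1 : G) =
      ContinuousLinearMap.id _ _ := by
    have : (fun y : G => x⁻¹ * y) ∘ (fun y => x * y) = id := by ext y; simp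
    rw [this, id_eq, mfderiv_id]
  rw [mfderiv_comp (I' := 𝓡 6) _ (hd _ _) (hd _ _)] at A
  intro a b hab
  have h1 := congrArg (mfderiv (𝓡 6) (𝓡 6) (fun y : G => x⁻¹ * y) (x * 1))
    (show mfderiv (𝓡 6) (𝓡 6) (fun y : G => x * y) 1 a = mfderiv (𝓡 6) (𝓡 6) (fun y : G => x * y) 1 b
      from hab)
  have h2 := DFunLike.congr_fun A a
  have h3 := DFunLike.congr_fun A b
  exact h2.symm.trans (h1.trans h3)

/-- Coordinates of a parallel field along a curve. -/
theorem IsParallelTransport.exists_hasDerivWithinAt {N : LieAlg G →ₗ[ℝ] LieAlg G →ₗ[ℝ] LieAlg G}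
    {c : ℝ → G} {tau : LieAlg G →ₗ[ℝ] LieAlg G} (h : IsParallelTransport N c tau) :
    ∃ xi : ℝ → LieAlg G, ∀ v : LieAlg G, ∃ V : ℝ → LieAlg G, V 0 = v ∧ V 1 = tau v ∧
      ∀ φ : LieAlg G →ₗ[ℝ] ℝ, ∀ t ∈ Set.Icc (0 : ℝ) 1,
        HasDerivWithinAt (fun s => φ (V s)) (-φ (N (xi t) (V t))) (Set.Icc 0 1) t := by
  have hx : ∃ xi : ℝ → LieAlg G, ∀ t ∈ Set.Icc (0 : ℝ) 1,
      mfderiv 𝓘(ℝ, ℝ) (𝓡 6) c t (1 : ℝ) = mulInvariantVectorField (xi t) (c t) := by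
    obtain ⟨V, -, -, hV⟩ := h 0
    choose! xi hxi _ using hV
    exact ⟨xi, hxi⟩
  obtain ⟨xi, hxi⟩ := hx
  refine ⟨xi, fun v => ?_⟩
  obtain ⟨V, h0, h1, hV⟩ := h v
  refine ⟨V, h0, h1, fun φ t ht => ?_⟩
  obtain ⟨eta, he, hd⟩ := hV t ht
  -- The definition lets the logarithmic derivative depend on the initial vector; injectivity gives
  -- one `xi` for all parallel fields, so that several can be differentiated together.
  have : eta = xi t := mulInvariantVectorField_injective (c t) (he.symm.trans (hxi t ht))
  subst this
  have := φ.hasDerivWithinAt_comp (E := EuclideanSpace ℝ (Fin 6)) hd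
  exact this.congr_deriv (map_neg φ _)

theorem eq_of_hasDerivWithinAt_zero {E : Type*} [NormedAddCommGroup E] [NormedSpace ℝ E]
    {f : ℝ → E} (h : ∀ t ∈ Set.Icc (0 : ℝ) 1, HasDerivWithinAt f 0 (Set.Icc 0 1) t) :
    f 1 = f 0 := by
  have := (convex_Icc (0 : ℝ) 1).norm_image_sub_le_of_norm_hasDerivWithin_le (C := 0) h
    (fun t _ => by simp) (Set.left_mem_Icc.mpr zero_le_one) (Set.right_mem_Icc.mpr zero_le_one)
  simpa [sub_eq_zero] using this

/-- An invariant tensor annihilated by the connection is constant on parallel fields. -/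
theorem holonomy_subset_stabSU3 (Γ : Subgroup G) {J : LieAlg G →ₗ[ℝ] LieAlg G}
    {g : LieAlg G →ₗ[ℝ] LieAlg G →ₗ[ℝ] ℝ} {e : Module.Basis (Fin 6) ℝ (LieAlg G)}
    (hg : IsHermitianStructure J g) (he : IsAdapted J g e)
    {N : LieAlg G →ₗ[ℝ] LieAlg G →ₗ[ℝ] LieAlg G} (hm : PreservesMetric g N)
    (hJ : PreservesJ J N) (hP : PreservesVolForm (volForm e) N) (x : G) :
    holonomy Γ N x ⊆ stabSU3 J g (volForm e) := by
  rintro tau ⟨c, -, -, -, ht⟩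
  obtain ⟨xi, hxi⟩ := ht.exists_hasDerivWithinAt
  choose V h0 h1 hV using hxi
  have hc : ∀ X i, ∀ t ∈ Set.Icc (0 : ℝ) 1,
      HasDerivWithinAt (fun s => cof e i (V X s)) (-cof e i (N (xi t) (V X t))) (Set.Icc 0 1) t :=
    fun X i t ht => hV X (e.coord i) t ht
  have hgm := he.metric_eq hg.complex
  have hpair : ∀ (A B : ℝ → LieAlg G),
      (∀ i, ∀ t ∈ Set.Icc (0 : ℝ) 1,
        HasDerivWithinAt (fun s => cof e i (A s)) (-cof e i (N (xi t) (A t))) (Set.Icc 0 1) t) →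
      (∀ i, ∀ t ∈ Set.Icc (0 : ℝ) 1,
        HasDerivWithinAt (fun s => cof e i (B s)) (-cof e i (N (xi t) (B t))) (Set.Icc 0 1) t) →
      g (A 1) (B 1) = g (A 0) (B 0) := by
    intro A B hA hB
    refine eq_of_hasDerivWithinAt_zero (f := fun s => g (A s) (B s)) fun t ht => ?_
    simp only [hgm]
    have h := HasDerivWithinAt.fun_sum (u := Finset.univ)
      fun i _ => (hA i t ht).fun_mul (hB i t ht)
    convert! h using 1
    have := hm (xi t) (A t) (B t)
    simp only [hgm] at this
    rw [← neg_eq_zero, neg_add, ← Finset.sum_neg_distrib, ← Finset.sum_neg_distrib,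
      ← Finset.sum_add_distrib] at this
    rw [← this]
    exact Finset.sum_congr rfl fun i _ => by ring
  refine ⟨fun X => ?_, fun X Y => ?_, fun X Y Z => ?_⟩
  -- The difference of the transport of `J X` and `J` of the transport of `X` solves the parallel
  -- equation and starts at zero. Its norm is constant, so it stays zero.
  · have hD : ∀ i, ∀ t ∈ Set.Icc (0 : ℝ) 1,
        HasDerivWithinAt (fun s => cof e i (V (J X) s - J (V X s)))
          (-cof e i (N (xi t) (V (J X) t - J (V X t)))) (Set.Icc 0 1) t := by
      intro i t ht
      have h := (hc (J X) i t ht).fun_sub (hV X ((e.coord i).comp J) t ht)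
      simp only [cof_sub, map_sub, hJ (xi t)]
      convert! h using 1
      simp [cof]
      ring
    have h := hpair _ _ hD hD
    simp only [h0, sub_self, map_zero, h1] at h
    by_contra hne
    have := hg.pos _ (sub_ne_zero.mpr hne)
    exact this.ne' h
  · have h := hpair (V X) (V Y) (hc X) (hc Y)
    rwa [h0, h0, h1, h1] at h
  · have hC : ∀ X i j, ∀ t ∈ Set.Icc (0 : ℝ) 1,
        HasDerivWithinAt (fun s => (cof e i (V X s) : ℂ) + Complex.I * cof e j (V X s))
          (-((cof e i (N (xi t) (V X t)) : ℂ) + Complex.I * cof e j (N (xi t) (V X t))))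
          (Set.Icc 0 1) t := by
      intro X i j t ht
      have h := (hc X i t ht).ofReal_comp.fun_add ((hc X j t ht).ofReal_comp.const_mul Complex.I)
      convert! h using 1
      push_cast
      ring
    have h : volForm e (V X 1) (V Y 1) (V Z 1) = volForm e (V X 0) (V Y 0) (V Z 0) := by
      refine eq_of_hasDerivWithinAt_zero (f := fun s => volForm e (V X s) (V Y s) (V Z s))
        fun t ht => ?_
      have hp := hP (xi t) (V X t) (V Y t) (V Z t)
      simp only [volForm, Matrix.det_fin_three, Matrix.of_apply, Matrix.cons_val_zero,
        Matrix.cons_val_one, Matrix.cons_val] at hp ⊢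
      have m : ∀ A B C i j k l m n, _ := fun A B C i j k l m n =>
        ((hC A i j t ht).fun_mul (hC B k l t ht)).fun_mul (hC C m n t ht)
      have h := (((((m X Y Z 0 1 2 3 4 5).fun_sub (m X Z Y 0 1 2 3 4 5)).fun_sub
        (m Y X Z 0 1 2 3 4 5)).fun_add (m Y Z X 0 1 2 3 4 5)).fun_add
        (m Z X Y 0 1 2 3 4 5)).fun_sub (m Z Y X 0 1 2 3 4 5)
      convert! h using 1
      rw [← neg_eq_zero] at hp
      rw [← hp]
      ring
    rwa [h0, h0, h0, h1, h1, h1] at h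

end Holonomy

/-! ### Existence of adapted frames with anti-self-dual structure equations. -/

section Existence

variable {L : Type*} [LieRing L] [LieAlgebra ℝ L]
  {J : L →ₗ[ℝ] L} {g : L →ₗ[ℝ] L →ₗ[ℝ] ℝ}

theorem cof_zero (e : Module.Basis (Fin 6) ℝ L) (i : Fin 6) : cof e i 0 = 0 := by simp [cof]

theorem sum_cof_smul (e : Module.Basis (Fin 6) ℝ L) (X : L) : ∑ i, cof e i X • e i = X :=
  e.sum_repr X

theorem IsHermitianStructure.apply_J_left (hg : IsHermitianStructure J g) (X Y : L) :
    g (J X) Y = -g X (J Y) := by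
  rw [← hg.compat X, hg.complex.sq, map_neg, neg_neg]

theorem IsHermitianStructure.apply_J_self (hg : IsHermitianStructure J g) (X : L) :
    g X (J X) = 0 := by
  have h1 := hg.apply_J_left X X
  have h2 := hg.symm X (J X)
  linarith

/-- A unitary frame, given by its complex part, is an adapted basis. -/
theorem IsHermitianStructure.exists_isAdapted (hg : IsHermitianStructure J g)
    (hL : Module.finrank ℝ L = 6) {x y z : L}
    (h : g x x = 1 ∧ g y y = 1 ∧ g z z = 1 ∧ g x y = 0 ∧ g x (J y) = 0 ∧ g x z = 0 ∧
      g x (J z) = 0 ∧ g y z = 0 ∧ g y (J z) = 0) :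
    ∃ e : Module.Basis (Fin 6) ℝ L, IsAdapted J g e ∧
      (∀ i, e i = ![x, -J x, y, -J y, z, -J z] i) ∧
      ∀ X, cof e 0 X = g x X ∧ cof e 1 X = g x (J X) ∧ cof e 2 X = g y X ∧
        cof e 3 X = g y (J X) ∧ cof e 4 X = g z X ∧ cof e 5 X = g z (J X) := by
  obtain ⟨hx, hy, hz, hxy, hxy', hxz, hxz', hyz, hyz'⟩ := h
  have swap : ∀ {a b : L}, g a b = 0 → g b a = 0 := fun h => (hg.symm _ _).trans h
  have swapJ : ∀ {a b : L}, g a (J b) = 0 → g b (J a) = 0 := fun {a b} h => by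
    rw [hg.symm, hg.apply_J_left, h, neg_zero]
  set f : Fin 6 → L := ![x, -J x, y, -J y, z, -J z] with hf
  have ho : ∀ i j, g (f i) (f j) = if i = j then 1 else 0 := by
    intro i j
    fin_cases i <;> fin_cases j <;>
      simp [hf, hg.apply_J_left, hg.complex.sq, hx, hy, hz, hxy, hxy', hxz, hxz', hyz, hyz',
        swap hxy, swap hxz, swap hyz, swapJ hxy', swapJ hxz', swapJ hyz', hg.apply_J_self]
  have hli : LinearIndependent ℝ f := by
    rw [Fintype.linearIndependent_iff]
    intro c hc i
    have := congrArg (g (f i)) hc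
    simpa [ho] using this
  set e := basisOfLinearIndependentOfCardEqFinrank hli (by simp [hL]) with he
  have hef : ∀ i, e i = f i := fun i => by simp [he]
  have hcf : ∀ i X, cof e i X = g (f i) X := fun i X => by
    conv_rhs => rw [← sum_cof_smul e X]
    simp [hef, ho]
  have hc : ∀ X, cof e 0 X = g x X ∧ cof e 1 X = g x (J X) ∧ cof e 2 X = g y X ∧
        cof e 3 X = g y (J X) ∧ cof e 4 X = g z X ∧ cof e 5 X = g z (J X) := fun X => by
    simp [hcf, hf, hg.apply_J_left]
  refine ⟨e, ⟨fun X => ?_, fun X => ?_, fun X => ?_, ?_⟩, hef, hc⟩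
  · rw [(hc _).1, (hc _).2.1]
  · rw [(hc _).2.2.1, (hc _).2.2.2.1]
  · rw [(hc _).2.2.2.2.1, (hc _).2.2.2.2.2]
  · funext X Y
    obtain ⟨x0, x1, x2, x3, x4, x5⟩ := hc X
    obtain ⟨y0, y1, y2, y3, y4, y5⟩ := hc Y
    obtain ⟨z0, z1, z2, z3, z4, z5⟩ := hc (J Y)
    rw [hg.complex.sq, map_neg] at z1 z3 z5
    have h : g X (J Y) = ∑ i, cof e i X * cof e i (J Y) := by
      conv_lhs => rw [← sum_cof_smul e X, map_sum]
      simp [hcf, hef]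
    rw [fundForm, h, Fin.sum_univ_six, z0, z1, z2, z3, z4, z5]
    simp only [Pi.add_apply, cof2, wedge11, x0, x1, x2, x3, x4, x5, y0, y1, y2, y3, y4, y5]
    ring

theorem IsHermitianStructure.exists_unit_orthogonal (hg : IsHermitianStructure J g)
    [FiniteDimensional ℝ L] {k : ℕ} (hk : k < Module.finrank ℝ L) (u : Fin k → L) :
    ∃ x, g x x = 1 ∧ ∀ i, g (u i) x = 0 := by
  have h : LinearMap.ker (LinearMap.pi fun i => g (u i)) ≠ ⊥ :=
    LinearMap.ker_ne_bot_of_finrank_lt (by simpa using hk)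
  obtain ⟨p, hp, hp0⟩ := (Submodule.ne_bot_iff _).mp h
  have hpos := hg.pos p hp0
  refine ⟨(√(g p p))⁻¹ • p, ?_, fun i => ?_⟩
  · simp only [map_smul, LinearMap.smul_apply, smul_eq_mul]
    have := Real.mul_self_sqrt hpos.le
    have h0 := (Real.sqrt_pos.mpr hpos).ne'
    field_simp
    rw [pow_two, this]
  · have : g (u i) p = 0 := congrFun (LinearMap.mem_ker.mp hp) i
    rw [map_smul, this, smul_zero]

/-- For an abelian complex structure on `𝔥₅`, the center is a complex line, and it is the
commutator ideal. -/
theorem IsH5.exists_central (h5 : IsH5 L) (hJ : IsComplexStructure J) (hA : IsAbelianStructure J) :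
    ∃ c : L, c ≠ 0 ∧ (∀ X : L, ⁅c, X⁆ = 0) ∧ (∀ X : L, ⁅J c, X⁆ = 0) ∧
      (∀ X Y : L, ∃ a b : ℝ, ⁅X, Y⁆ = a • c + b • J c) ∧
      ∀ φ : L →ₗ[ℝ] ℝ, (∀ X Y : L, φ ⁅X, Y⁆ = 0) → φ c = 0 ∧ φ (J c) = 0 := by
  obtain ⟨f, hc, h4, h5⟩ := h5
  have hb : ∀ X Y, (∀ i : Fin 6, i < 4 → cof f i ⁅X, Y⁆ = 0) := fun X Y i hi => by
    have := congrFun (congrFun (hc i hi) X) Y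
    simpa [d1] using this
  have hb4 : ∀ X Y, cof f 4 ⁅X, Y⁆ = -(cof f 0 X * cof f 2 Y - cof f 2 X * cof f 0 Y +
      (cof f 3 X * cof f 1 Y - cof f 1 X * cof f 3 Y)) := fun X Y => by
    have := congrFun (congrFun h4 X) Y
    simp only [d1, Pi.add_apply, cof2, wedge11] at this
    linarith
  have hb5 : ∀ X Y, cof f 5 ⁅X, Y⁆ = -(cof f 0 X * cof f 3 Y - cof f 3 X * cof f 0 Y +
      (cof f 1 X * cof f 2 Y - cof f 2 X * cof f 1 Y)) := fun X Y => by
    have := congrFun (congrFun h5 X) Y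
    simp only [d1, Pi.add_apply, cof2, wedge11] at this
    linarith
  have hbr : ∀ X Y : L, ⁅X, Y⁆ = cof f 4 ⁅X, Y⁆ • f 4 + cof f 5 ⁅X, Y⁆ • f 5 := fun X Y => by
    conv_lhs => rw [← sum_cof_smul f ⁅X, Y⁆, Fin.sum_univ_six, hb X Y 0 (by decide),
      hb X Y 1 (by decide), hb X Y 2 (by decide), hb X Y 3 (by decide)]
    simp
  have hcent : ∀ X : L, ⁅f 4, X⁆ = 0 := fun X => by
    rw [hbr, hb4, hb5]
    simp [cof_basis]
  -- Abelian `J` preserves the centre: [Jc, X] = [J²c, JX] = -[c, JX].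
  have hJcent : ∀ X : L, ⁅J (f 4), X⁆ = 0 := fun X => by
    rw [← hA, hJ.sq, neg_lie, hcent, neg_zero]
  have hz : ∀ X : L, cof f 4 ⁅J (f 4), X⁆ = 0 := fun X => by rw [hJcent]; simp [cof]
  have j0 := hz (f 2)
  have j2 := hz (f 0)
  have j3 := hz (f 1)
  have j1 := hz (f 3)
  simp [hb4, cof_basis] at j0 j1 j2 j3
  set a := cof f 4 (J (f 4)) with ha
  set b := cof f 5 (J (f 4)) with hbdef
  have hJf : J (f 4) = a • f 4 + b • f 5 := by
    conv_lhs => rw [← sum_cof_smul f (J (f 4)), Fin.sum_univ_six, j0, j1, j2, j3]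
    simp [ha, hbdef]
  -- Otherwise `f 4` would be a real eigenvector of `J`, impossible as J² = -1.
  have hb0 : b ≠ 0 := by
    intro h0
    rw [h0, zero_smul, add_zero] at hJf
    have h1 := hJ.sq (f 4)
    rw [hJf, map_smul, hJf] at h1
    have h2 := congrArg (cof f 4) h1
    simp only [cof_smul, cof_neg, cof_basis] at h2
    simp at h2
    nlinarith [mul_self_nonneg a]
  have hf5 : f 5 = b⁻¹ • (J (f 4) - a • f 4) := by
    rw [hJf, add_sub_cancel_left, smul_smul, inv_mul_cancel₀ hb0, one_smul]
  refine ⟨f 4, f.ne_zero 4, hcent, hJcent, fun X Y => ?_, fun φ hφ => ?_⟩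
  · refine ⟨cof f 4 ⁅X, Y⁆ - cof f 5 ⁅X, Y⁆ * b⁻¹ * a, cof f 5 ⁅X, Y⁆ * b⁻¹, ?_⟩
    conv_lhs => rw [hbr, hf5]
    module
  · have h1 := hφ (f 2) (f 0)
    have h2 := hφ (f 3) (f 0)
    rw [hbr, hb4, hb5] at h1 h2
    simp [cof_basis] at h1 h2
    simp [hJf, h1, h2]

theorem d1_cof_ext {e : Module.Basis (Fin 6) ℝ L} {k : Fin 6} {v : Fin 3 → ℝ}
    (h : ∀ i j, d1 (cof e k) (e i) (e j) = asdForm e v (e i) (e j)) :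
    d1 (cof e k) = asdForm e v := by
  have key := LinearMap.ext_basis e e
    (B := LinearMap.mk₂ ℝ (d1 (cof e k))
      (fun X X' Y => by simp only [d1, add_lie, cof_add]; ring)
      (fun r X Y => by simp only [d1, smul_lie, cof_smul, smul_eq_mul]; ring)
      (fun X Y Y' => by simp only [d1, lie_add, cof_add]; ring)
      (fun r X Y => by simp only [d1, lie_smul, cof_smul, smul_eq_mul]; ring))
    (B' := LinearMap.mk₂ ℝ (asdForm e v)
      (fun X X' Y => by simp only [asdForm_apply, cof_add]; ring)
      (fun r X Y => by simp only [asdForm_apply, cof_smul, smul_eq_mul]; ring)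
      (fun X Y Y' => by simp only [asdForm_apply, cof_add]; ring)
      (fun r X Y => by simp only [asdForm_apply, cof_smul, smul_eq_mul]; ring)) h
  funext X Y
  exact DFunLike.congr_fun (DFunLike.congr_fun key X) Y

/-- A balanced Hermitian structure with abelian `J` on `𝔥₅` has an adapted basis with anti-self-dual
structure equations. -/
theorem exists_hasASDEquations (h5 : IsH5 L) (hA : IsAbelianStructure J)
    (hg : IsHermitianStructure J g) (hb : IsBalanced J g) :
    ∃ (e : Module.Basis (Fin 6) ℝ L) (v w : Fin 3 → ℝ),
      IsAdapted J g e ∧ HasASDEquations e v w := by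
  have hfr : Module.finrank ℝ L = 6 := by
    obtain ⟨f, -⟩ := h5
    simpa using Module.finrank_eq_card_basis f
  have : FiniteDimensional ℝ L := Module.finite_of_finrank_pos (by omega)
  obtain ⟨c, hc0, hcc, hJcc, hspan, -⟩ := h5.exists_central hg.complex hA
  have hpos := hg.pos c hc0
  set r := √(g c c) with hr
  have hr0 : r ≠ 0 := (Real.sqrt_pos.mpr hpos).ne'
  obtain ⟨z, hz⟩ : ∃ z, z = r⁻¹ • c := ⟨_, rfl⟩
  have hcz : c = r • z := by rw [hz, smul_smul, mul_inv_cancel₀ hr0, one_smul]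
  have hzz : g z z = 1 := by
    have := Real.mul_self_sqrt hpos.le
    rw [hz]
    simp only [map_smul, LinearMap.smul_apply, smul_eq_mul]
    rw [← this, ← hr]
    field_simp
  have hzc : ∀ X : L, ⁅z, X⁆ = 0 := fun X => by rw [hz, smul_lie, hcc, smul_zero]
  have hJzc : ∀ X : L, ⁅J z, X⁆ = 0 := fun X => by rw [hz, map_smul, smul_lie, hJcc, smul_zero]
  obtain ⟨x, hxx, hx⟩ := hg.exists_unit_orthogonal (k := 2) (by omega) ![z, J z]
  obtain ⟨y, hyy, hy⟩ := hg.exists_unit_orthogonal (k := 4) (by omega) ![z, J z, x, J x]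
  have hx0 : g z x = 0 := hx 0
  have hx1 : g (J z) x = 0 := hx 1
  have hy0 : g z y = 0 := hy 0
  have hy1 : g (J z) y = 0 := hy 1
  have hy2 : g x y = 0 := hy 2
  have hy3 : g (J x) y = 0 := hy 3
  obtain ⟨e, he, hev, -⟩ := hg.exists_isAdapted hfr ⟨hxx, hyy, hzz, hy2,
    by rw [hg.apply_J_left] at hy3; linarith, (hg.symm _ _).trans hx0, (hg.symm _ _).trans hx1,
    (hg.symm _ _).trans hy0, (hg.symm _ _).trans hy1⟩
  have hclosed : ∀ i : Fin 6, i < 4 → ∀ X Y : L, cof e i ⁅X, Y⁆ = 0 := by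
    have e4 : e 4 = z := hev 4
    have e5 : J z = -e 5 := by rw [hev 5]; simp
    intro i hi X Y
    obtain ⟨a, b, hab⟩ := hspan X Y
    have h4 : i ≠ 4 := by rintro rfl; exact absurd hi (by decide)
    have h5' : i ≠ 5 := by rintro rfl; exact absurd hi (by decide)
    rw [hab, hcz, map_smul, e5, ← e4]
    simp [cof_add, cof_smul, cof_neg, cof_basis, h4, h5']
  have e0 : J (e 0) = -e 1 := by rw [hev, hev]; simp
  have e1 : J (e 1) = e 0 := by rw [hev, hev]; simp [hg.complex.sq]
  have e2 : J (e 2) = -e 3 := by rw [hev, hev]; simp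
  have e3 : J (e 3) = e 2 := by rw [hev, hev]; simp [hg.complex.sq]
  have e4 : ∀ X : L, ⁅e 4, X⁆ = 0 := fun X => by rw [hev]; exact hzc X
  have e5 : ∀ X : L, ⁅e 5, X⁆ = 0 := fun X => by rw [hev]; simp [hJzc]
  have e4' : ∀ X : L, ⁅X, e 4⁆ = 0 := fun X => by rw [← lie_skew, e4, neg_zero]
  have e5' : ∀ X : L, ⁅X, e 5⁆ = 0 := fun X => by rw [← lie_skew, e5, neg_zero]
  have b13 : ⁅e 1, e 3⁆ = ⁅e 0, e 2⁆ := by rw [← hA (e 0), e0, e2, neg_lie, lie_neg, neg_neg]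
  have b12 : ⁅e 1, e 2⁆ = -⁅e 0, e 3⁆ := by rw [← hA (e 0), e0, e3, neg_lie, neg_neg]
  have hbal : ∀ W, wedge23 (fundForm J g) (d2 (fundForm J g)) (e 0) (e 1) (e 2) (e 3) W = 0 :=
    fun W => by rw [hb]; rfl
  -- Here dF = de⁵ ∧ e⁶ - e⁵ ∧ de⁶, so evaluating F ∧ dF with last entry `e 5` isolates the trace of
  -- de⁵, and with `e 4` that of de⁶.
  have htr : ∀ k : Fin 6, k = 4 ∨ k = 5 → cof e k ⁅e 2, e 3⁆ = -cof e k ⁅e 0, e 1⁆ := by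
    have c0 := hclosed 0 (by decide)
    have c1 := hclosed 1 (by decide)
    have c2 := hclosed 2 (by decide)
    have c3 := hclosed 3 (by decide)
    rintro k (rfl | rfl)
    · have := hbal (e 5)
      simp [wedge23, d2, he.fund, cof2, wedge11, c0, c1, c2, c3, e5', cof_basis, cof_zero] at this
      linarith
    · have := hbal (e 4)
      simp [wedge23, d2, he.fund, cof2, wedge11, c0, c1, c2, c3, e4', cof_basis, cof_zero] at this
      linarith
  have hd : ∀ k : Fin 6, k = 4 ∨ k = 5 → d1 (cof e k) =
      asdForm e ![-cof e k ⁅e 0, e 1⁆, -cof e k ⁅e 0, e 2⁆, -cof e k ⁅e 0, e 3⁆] := by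
    intro k hk
    refine d1_cof_ext fun i j => ?_
    have s : ∀ i j : Fin 6, cof e k ⁅e i, e j⁆ = -cof e k ⁅e j, e i⁆ := fun i j => by
      rw [← lie_skew, cof_neg]
    have h23 := htr k hk
    have s10 := s 1 0
    have s20 := s 2 0
    have s30 := s 3 0
    have s21 := s 2 1
    have s31 := s 3 1
    have s32 := s 3 2
    rw [b12, cof_neg] at s21
    rw [b13] at s31
    rw [h23] at s32
    fin_cases i <;> fin_cases j <;>
      simp [d1, asdForm_apply, cof_basis, e4, e5, e4', e5', cof_zero, b13, b12, s10, s20, s30,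
        s21, s31, s32, h23]
  exact ⟨e, _, _, he, ⟨fun i hi => by funext X Y; simp [d1, hclosed i hi], hd 4 (Or.inl rfl),
    hd 5 (Or.inr rfl)⟩⟩

/-- A relation a v + b w = 0 makes a e⁵ + b e⁶ vanish on brackets, hence on the central vector c and
on Jc. On the central line `J` is a quarter turn, so these two equations in (a, b) have nonzero
determinant. -/
theorem HasASDEquations.linearIndependent {e : Module.Basis (Fin 6) ℝ L} {v w : Fin 3 → ℝ}
    (h : HasASDEquations e v w) (h5 : IsH5 L) (hJ : IsComplexStructure J)
    (hA : IsAbelianStructure J) (he : IsAdapted J g e) : LinearIndependent ℝ ![v, w] := by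
  rw [LinearIndependent.pair_iff]
  intro a b hab
  obtain ⟨c, hc0, -, -, -, hφ⟩ := h5.exists_central hJ hA
  obtain ⟨j0, j1, j2, j3, j4, j5⟩ := he.cof_J hJ c
  have c0 : cof e 0 c = 0 := (hφ (e.coord 0) fun X Y => (h.cof_bracket X Y).1).1
  have c1 : cof e 1 c = 0 := (hφ (e.coord 1) fun X Y => (h.cof_bracket X Y).2.1).1
  have c2 : cof e 2 c = 0 := (hφ (e.coord 2) fun X Y => (h.cof_bracket X Y).2.2.1).1
  have c3 : cof e 3 c = 0 := (hφ (e.coord 3) fun X Y => (h.cof_bracket X Y).2.2.2.1).1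
  obtain ⟨h1, h2⟩ := hφ (a • e.coord 4 + b • e.coord 5) fun X Y => by
    obtain ⟨-, -, -, -, h4, h5⟩ := h.cof_bracket X Y
    change a * cof e 4 ⁅X, Y⁆ + b * cof e 5 ⁅X, Y⁆ = 0
    have h0 := congrFun hab 0
    have h1 := congrFun hab 1
    have h2 := congrFun hab 2
    simp only [Pi.add_apply, Pi.smul_apply, smul_eq_mul, Pi.zero_apply] at h0 h1 h2
    rw [h4, h5, asdForm_apply, asdForm_apply]
    linear_combination
      (-(cof e 0 X * cof e 1 Y - cof e 1 X * cof e 0 Y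
        - (cof e 2 X * cof e 3 Y - cof e 3 X * cof e 2 Y))) * h0
      - (cof e 0 X * cof e 2 Y - cof e 2 X * cof e 0 Y
        + (cof e 1 X * cof e 3 Y - cof e 3 X * cof e 1 Y)) * h1
      - (cof e 0 X * cof e 3 Y - cof e 3 X * cof e 0 Y
        - (cof e 1 X * cof e 2 Y - cof e 2 X * cof e 1 Y)) * h2
  change a * cof e 4 c + b * cof e 5 c = 0 at h1
  change a * cof e 4 (J c) + b * cof e 5 (J c) = 0 at h2
  rw [j4, j5] at h2
  have hne : cof e 4 c ^ 2 + cof e 5 c ^ 2 ≠ 0 := by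
    intro h0
    apply hc0
    have h4 : cof e 4 c = 0 := by nlinarith [sq_nonneg (cof e 4 c), sq_nonneg (cof e 5 c)]
    have h5 : cof e 5 c = 0 := by nlinarith [sq_nonneg (cof e 4 c), sq_nonneg (cof e 5 c)]
    rw [← sum_cof_smul e c, Fin.sum_univ_six, c0, c1, c2, c3, h4, h5]
    simp
  have ha : a * (cof e 4 c ^ 2 + cof e 5 c ^ 2) = 0 := by
    linear_combination cof e 4 c * h1 + cof e 5 c * h2
  have hb : b * (cof e 4 c ^ 2 + cof e 5 c ^ 2) = 0 := by
    linear_combination cof e 5 c * h1 - cof e 4 c * h2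
  exact ⟨(mul_eq_zero.mp ha).resolve_right hne, (mul_eq_zero.mp hb).resolve_right hne⟩

end Existence

/-! ### Action of unitary frame changes on the pair (v, w). -/

section NormalForm

/-- Take the unit complex number (a + ib)/(x + iy), or 1 when both vectors vanish. -/
theorem exists_rotation {a b x y : ℝ} (h : a ^ 2 + b ^ 2 = x ^ 2 + y ^ 2) :
    ∃ c s : ℝ, c ^ 2 + s ^ 2 = 1 ∧ c * x - s * y = a ∧ s * x + c * y = b := by
  by_cases h0 : x ^ 2 + y ^ 2 = 0
  · have hx : x = 0 := by nlinarith [sq_nonneg x, sq_nonneg y]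
    have hy : y = 0 := by nlinarith [sq_nonneg x, sq_nonneg y]
    have ha : a = 0 := by nlinarith [sq_nonneg a, sq_nonneg b]
    have hb : b = 0 := by nlinarith [sq_nonneg a, sq_nonneg b]
    exact ⟨1, 0, by norm_num, by simp [hx, ha], by simp [hy, hb]⟩
  · refine ⟨(a * x + b * y) / (x ^ 2 + y ^ 2), (b * x - a * y) / (x ^ 2 + y ^ 2), ?_, ?_, ?_⟩
    · field_simp
      linear_combination (x ^ 2 + y ^ 2) * h
    · field_simp
      ring
    · field_simp
      ring

/-- A square root of C + iS. It is needed because some frame rotations act on v, w, or on their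
inner products, through twice the angle. -/
theorem exists_half_angle {C S : ℝ} (h : C ^ 2 + S ^ 2 = 1) :
    ∃ c s : ℝ, c ^ 2 + s ^ 2 = 1 ∧ c ^ 2 - s ^ 2 = C ∧ 2 * c * s = S := by
  by_cases hC : C = -1
  · subst hC
    have hS : S = 0 := by nlinarith
    exact ⟨0, 1, by norm_num, by norm_num, by simp [hS]⟩
  · have h1 : 0 < (1 + C) / 2 := by
      have : 0 ≤ 1 + C := by nlinarith [sq_nonneg S]
      have : 1 + C ≠ 0 := fun h => hC (by linarith)
      positivity
    have h2 := Real.sq_sqrt h1.le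
    have h3 := (Real.sqrt_pos.mpr h1).ne'
    have h4 : (S / (2 * √((1 + C) / 2))) ^ 2 = (1 - C) / 2 := by
      rw [div_pow, mul_pow, h2, div_eq_iff (by positivity)]
      linear_combination h
    refine ⟨√((1 + C) / 2), S / (2 * √((1 + C) / 2)), ?_, ?_, ?_⟩
    · rw [h2, h4]; ring
    · rw [h2, h4]; ring
    · field_simp

variable {L : Type*} [LieRing L] [LieAlgebra ℝ L]
  {J : L →ₗ[ℝ] L} {g : L →ₗ[ℝ] L →ₗ[ℝ] ℝ}

theorem HasASDEquations.of_cof_bracket {e : Module.Basis (Fin 6) ℝ L} {v w : Fin 3 → ℝ}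
    (h : ∀ X Y : L, cof e 0 ⁅X, Y⁆ = 0 ∧ cof e 1 ⁅X, Y⁆ = 0 ∧ cof e 2 ⁅X, Y⁆ = 0 ∧
      cof e 3 ⁅X, Y⁆ = 0 ∧ cof e 4 ⁅X, Y⁆ = -asdForm e v X Y ∧
      cof e 5 ⁅X, Y⁆ = -asdForm e w X Y) : HasASDEquations e v w := by
  refine ⟨fun i hi => ?_, ?_, ?_⟩ <;> funext X Y <;> obtain ⟨h0, h1, h2, h3, h4, h5⟩ := h X Y
  · fin_cases i
    · simp [d1, h0]
    · simp [d1, h1]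
    · simp [d1, h2]
    · simp [d1, h3]
    · exact absurd hi (by decide)
    · exact absurd hi (by decide)
  · simp [d1, h4]
  · simp [d1, h5]

/-- `(J, g)` has an adapted basis with the anti-self-dual structure equations given by `v`, `w`. -/
def HasASDFrame (J : L →ₗ[ℝ] L) (g : L →ₗ[ℝ] L →ₗ[ℝ] ℝ) (v w : Fin 3 → ℝ) : Prop :=
  ∃ e : Module.Basis (Fin 6) ℝ L, IsAdapted J g e ∧ HasASDEquations e v w

/-- Effect of a phase change of the first complex frame vector. -/
theorem HasASDFrame.rotate_phase (hg : IsHermitianStructure J g) {v w : Fin 3 → ℝ}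
    (h : HasASDFrame J g v w) {c s : ℝ} (hcs : c ^ 2 + s ^ 2 = 1) :
    HasASDFrame J g ![v 0, c * v 1 - s * v 2, s * v 1 + c * v 2]
      ![w 0, c * w 1 - s * w 2, s * w 1 + c * w 2] := by
  obtain ⟨e, he, h⟩ := h
  have hm := he.metric_eq hg.complex
  have hj := he.cof_J hg.complex
  obtain ⟨e', he', -, hc⟩ := hg.exists_isAdapted (by simpa using Module.finrank_eq_card_basis e)
    (x := c • e 0 + s • e 1) (y := e 2) (z := e 4) (by
      refine ⟨?_, ?_, ?_, ?_, ?_, ?_, ?_, ?_, ?_⟩ <;>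
        simp [hm, hj, cof_add, cof_smul, cof_basis]
      · linarith)
  simp [hm, hj, cof_basis] at hc
  refine ⟨e', he', HasASDEquations.of_cof_bracket fun X Y => ?_⟩
  obtain ⟨a0, a1, a2, a3, a4, a5⟩ := h.cof_bracket X Y
  simp only [asdForm_apply] at a4 a5
  refine ⟨?_, ?_, ?_, ?_, ?_, ?_⟩ <;> simp [hc, asdForm_apply, a0, a1, a2, a3, a4, a5]
  · linear_combination (v 0 * (cof e 0 X * cof e 1 Y - cof e 1 X * cof e 0 Y)
      + v 1 * (cof e 0 X * cof e 2 Y - cof e 2 X * cof e 0 Y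
      + (cof e 1 X * cof e 3 Y - cof e 3 X * cof e 1 Y))
      + v 2 * (cof e 0 X * cof e 3 Y - cof e 3 X * cof e 0 Y
      - (cof e 1 X * cof e 2 Y - cof e 2 X * cof e 1 Y))) * hcs
  · linear_combination (w 0 * (cof e 0 X * cof e 1 Y - cof e 1 X * cof e 0 Y)
      + w 1 * (cof e 0 X * cof e 2 Y - cof e 2 X * cof e 0 Y
      + (cof e 1 X * cof e 3 Y - cof e 3 X * cof e 1 Y))
      + w 2 * (cof e 0 X * cof e 3 Y - cof e 3 X * cof e 0 Y
      - (cof e 1 X * cof e 2 Y - cof e 2 X * cof e 1 Y))) * hcs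

/-- Effect of a real rotation of the first two complex frame vectors. -/
theorem HasASDFrame.rotate_real (hg : IsHermitianStructure J g) {v w : Fin 3 → ℝ}
    (h : HasASDFrame J g v w) {c s : ℝ} (hcs : c ^ 2 + s ^ 2 = 1) :
    HasASDFrame J g ![(c ^ 2 - s ^ 2) * v 0 + 2 * c * s * v 2, v 1,
        -(2 * c * s) * v 0 + (c ^ 2 - s ^ 2) * v 2]
      ![(c ^ 2 - s ^ 2) * w 0 + 2 * c * s * w 2, w 1,
        -(2 * c * s) * w 0 + (c ^ 2 - s ^ 2) * w 2] := by
  obtain ⟨e, he, h⟩ := h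
  have hm := he.metric_eq hg.complex
  have hj := he.cof_J hg.complex
  obtain ⟨e', he', -, hc⟩ := hg.exists_isAdapted (by simpa using Module.finrank_eq_card_basis e)
    (x := c • e 0 + s • e 2) (y := c • e 2 - s • e 0) (z := e 4) (by
      refine ⟨?_, ?_, ?_, ?_, ?_, ?_, ?_, ?_, ?_⟩ <;>
        simp [hm, hj, cof_add, cof_sub, cof_smul, cof_basis]
      · linarith
      · linarith
      · ring)
  simp [hm, hj, cof_basis] at hc
  refine ⟨e', he', HasASDEquations.of_cof_bracket fun X Y => ?_⟩
  obtain ⟨a0, a1, a2, a3, a4, a5⟩ := h.cof_bracket X Y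
  simp only [asdForm_apply] at a4 a5
  refine ⟨?_, ?_, ?_, ?_, ?_, ?_⟩ <;> simp [hc, asdForm_apply, a0, a1, a2, a3, a4, a5]
  · linear_combination ((v 0 * (cof e 0 X * cof e 1 Y - cof e 1 X * cof e 0 Y
      - (cof e 2 X * cof e 3 Y - cof e 3 X * cof e 2 Y))
      + v 2 * (cof e 0 X * cof e 3 Y - cof e 3 X * cof e 0 Y
      - (cof e 1 X * cof e 2 Y - cof e 2 X * cof e 1 Y))) * (c ^ 2 + s ^ 2 + 1)
      + v 1 * (cof e 0 X * cof e 2 Y - cof e 2 X * cof e 0 Y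
      + (cof e 1 X * cof e 3 Y - cof e 3 X * cof e 1 Y))) * hcs
  · linear_combination ((w 0 * (cof e 0 X * cof e 1 Y - cof e 1 X * cof e 0 Y
      - (cof e 2 X * cof e 3 Y - cof e 3 X * cof e 2 Y))
      + w 2 * (cof e 0 X * cof e 3 Y - cof e 3 X * cof e 0 Y
      - (cof e 1 X * cof e 2 Y - cof e 2 X * cof e 1 Y))) * (c ^ 2 + s ^ 2 + 1)
      + w 1 * (cof e 0 X * cof e 2 Y - cof e 2 X * cof e 0 Y
      + (cof e 1 X * cof e 3 Y - cof e 3 X * cof e 1 Y))) * hcs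

/-- Effect of a phase change of the third complex frame vector. -/
theorem HasASDFrame.rotate_center (hg : IsHermitianStructure J g) {v w : Fin 3 → ℝ}
    (h : HasASDFrame J g v w) {c s : ℝ} (hcs : c ^ 2 + s ^ 2 = 1) :
    HasASDFrame J g (c • v + s • w) (c • w - s • v) := by
  obtain ⟨e, he, h⟩ := h
  have hm := he.metric_eq hg.complex
  have hj := he.cof_J hg.complex
  obtain ⟨e', he', -, hc⟩ := hg.exists_isAdapted (by simpa using Module.finrank_eq_card_basis e)
    (x := e 0) (y := e 2) (z := c • e 4 + s • e 5) (by
      refine ⟨?_, ?_, ?_, ?_, ?_, ?_, ?_, ?_, ?_⟩ <;>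
        simp [hm, hj, cof_add, cof_smul, cof_basis]
      · linarith)
  simp [hm, hj, cof_basis] at hc
  refine ⟨e', he', HasASDEquations.of_cof_bracket fun X Y => ?_⟩
  obtain ⟨a0, a1, a2, a3, a4, a5⟩ := h.cof_bracket X Y
  simp only [asdForm_apply] at a4 a5
  refine ⟨?_, ?_, ?_, ?_, ?_, ?_⟩ <;> simp [hc, asdForm_apply, a0, a1, a2, a3, a4, a5]
  · ring
  · ring

end NormalForm

/-! ### Reduction to the families A and B. -/

section StandardBases

variable {L : Type*} [LieRing L] [LieAlgebra ℝ L]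
  {J : L →ₗ[ℝ] L} {g : L →ₗ[ℝ] L →ₗ[ℝ] ℝ}

/-- After a phase change of the third complex frame vector, the two forms are orthogonal. -/
theorem HasASDFrame.exists_orthogonal (hg : IsHermitianStructure J g) {v w : Fin 3 → ℝ}
    (h : HasASDFrame J g v w) :
    ∃ v w, HasASDFrame J g v w ∧ v ⬝ᵥ w = 0 ∧ v ⬝ᵥ v ≤ w ⬝ᵥ w := by
  -- Rotating (v, w) by an angle rotates (x, y) by twice that angle; the target is the half-axis y =
  -- 0, x ≥ 0.
  set x := (w ⬝ᵥ w - v ⬝ᵥ v) / 2 with hx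
  set y := v ⬝ᵥ w with hy
  obtain ⟨C, S, hCS, h1, h2⟩ := exists_rotation (a := √(x ^ 2 + y ^ 2)) (b := 0) (x := x) (y := y)
    (by rw [Real.sq_sqrt (by positivity)]; ring)
  obtain ⟨c, s, hcs, hC, hS⟩ := exists_half_angle hCS
  refine ⟨_, _, h.rotate_center hg hcs, ?_, ?_⟩
  · simp only [add_dotProduct, dotProduct_sub, smul_dotProduct, dotProduct_smul, smul_eq_mul,
      dotProduct_comm w v, ← hy]
    rw [← hC, ← hS] at h2
    linear_combination h2 + 2 * c * s * hx
  · have h0 : 0 ≤ C * x - S * y := h1 ▸ Real.sqrt_nonneg _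
    simp only [add_dotProduct, dotProduct_sub, sub_dotProduct, dotProduct_add, smul_dotProduct,
      dotProduct_smul, smul_eq_mul, dotProduct_comm w v, ← hy]
    rw [← hC, ← hS] at h0
    linear_combination 2 * h0 - 2 * (c ^ 2 - s ^ 2) * hx

/-- Three rotations of ℝ³ carry v to the γ₂ axis; orthogonality then removes the γ₂ component of w.
-/
theorem HasASDFrame.exists_normalForm (hg : IsHermitianStructure J g) {v w : Fin 3 → ℝ}
    (h : HasASDFrame J g v w) (hvw : v ⬝ᵥ w = 0) (hle : v ⬝ᵥ v ≤ w ⬝ᵥ w) (hv : v ≠ 0) :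
    ∃ r p q : ℝ, r ≠ 0 ∧ r ^ 2 ≤ p ^ 2 + q ^ 2 ∧ HasASDFrame J g ![0, r, 0] ![p, 0, q] := by
  have hvv : 0 < v ⬝ᵥ v :=
    lt_of_le_of_ne (dotProduct_self_nonneg' _) fun h0 => hv (dotProduct_self_eq_zero.mp h0.symm)
  simp only [dotProduct, Fin.sum_univ_three] at hvw hle hvv
  obtain ⟨c, s, hcs, h1, h2⟩ := exists_rotation (a := √(v 1 ^ 2 + v 2 ^ 2)) (b := 0) (x := v 1)
    (y := v 2) (by rw [Real.sq_sqrt (by positivity)]; ring)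
  -- The phase change has removed the γ₃ component of v. A frame rotation by 45° is a quarter turn
  -- of the γ₁γ₃ plane and moves the γ₁ component to γ₃, where the next phase change can absorb it.
  have f1 := (h.rotate_phase hg hcs).rotate_real hg (c := √(1 / 2)) (s := √(1 / 2))
    (by rw [Real.sq_sqrt (by norm_num)]; norm_num)
  have hh : 2 * √(1 / 2 : ℝ) * √(1 / 2) = 1 := by
    rw [mul_assoc, Real.mul_self_sqrt (by norm_num)]; norm_num
  rw [h1, h2, hh] at f1
  simp at f1
  set m := √(v 1 ^ 2 + v 2 ^ 2) with hm
  obtain ⟨c', s', hcs', h1', h2'⟩ := exists_rotation (a := √(m ^ 2 + v 0 ^ 2)) (b := 0) (x := m)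
    (y := -v 0) (by rw [Real.sq_sqrt (by positivity)]; ring)
  have f2 := f1.rotate_phase hg hcs'
  simp at f2
  have hm2 : m ^ 2 = v 1 ^ 2 + v 2 ^ 2 := Real.sq_sqrt (by positivity)
  set r := √(m ^ 2 + v 0 ^ 2) with hr
  have hr2 : r ^ 2 = m ^ 2 + v 0 ^ 2 := Real.sq_sqrt (by positivity)
  have hr0 : r ≠ 0 := by
    intro h0
    rw [h0] at hr2
    nlinarith
  have e1 : c' * m + s' * v 0 = r := by linarith
  have e2 : s' * m + -(c' * v 0) = 0 := by linarith
  have i1 : m * (c * w 1 - s * w 2) + v 0 * w 0 = 0 := by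
    have : (c * v 1 - s * v 2) * (c * w 1 - s * w 2) + (s * v 1 + c * v 2) * (s * w 1 + c * w 2) =
        v 1 * w 1 + v 2 * w 2 := by linear_combination (v 1 * w 1 + v 2 * w 2) * hcs
    rw [h1, h2] at this
    linarith
  have i2 : (c * w 1 - s * w 2) ^ 2 + (s * w 1 + c * w 2) ^ 2 = w 1 ^ 2 + w 2 ^ 2 := by
    linear_combination (w 1 ^ 2 + w 2 ^ 2) * hcs
  set a := c * w 1 - s * w 2
  set b := s * w 1 + c * w 2
  have e3 : c' * a + s' * w 0 = 0 := by
    have : (c' * m + s' * v 0) * (c' * a + s' * w 0) +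
        (s' * m + -(c' * v 0)) * (s' * a + -(c' * w 0)) = m * a + v 0 * w 0 := by
      linear_combination (m * a + v 0 * w 0) * hcs'
    rw [e1, e2, i1, zero_mul, add_zero] at this
    exact (mul_eq_zero.mp this).resolve_left hr0
  have i3 : (c' * a + s' * w 0) ^ 2 + (s' * a + -(c' * w 0)) ^ 2 = a ^ 2 + w 0 ^ 2 := by
    linear_combination (a ^ 2 + w 0 ^ 2) * hcs'
  rw [e3] at i3
  rw [e1, e2, e3] at f2
  exact ⟨r, _, _, hr0, by linarith, f2⟩

/-- The two coefficients in the normal form can be rotated freely. -/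
theorem HasASDFrame.rotate_normalForm (hg : IsHermitianStructure J g) {r p q p' q' : ℝ}
    (h : HasASDFrame J g ![0, r, 0] ![p, 0, q]) (hpq : p' ^ 2 + q' ^ 2 = p ^ 2 + q ^ 2) :
    HasASDFrame J g ![0, r, 0] ![p', 0, q'] := by
  obtain ⟨C, S, hCS, h1, h2⟩ := exists_rotation hpq
  -- The sign is reversed because `rotate_real` turns the γ₁γ₃ plane in the opposite sense to
  -- `exists_rotation`.
  obtain ⟨c, s, hcs, hC, hS⟩ := exists_half_angle (C := C) (S := -S) (by linarith [neg_sq S])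
  have f := h.rotate_real hg hcs
  rw [hC, hS] at f
  simp at f
  rwa [← sub_eq_add_neg, h1, h2] at f

theorem StructureEquationsA.exists_hasASDEquations {e : Module.Basis (Fin 6) ℝ L}
    (h : StructureEquationsA e) : ∃ v w, HasASDEquations e v w := by
  obtain ⟨hc, s, t, -, -, h4, h5⟩ := h
  refine ⟨![0, t / s, 0], ![-2 * t, 0, -(t / s)], hc, ?_, ?_⟩
  · rw [h4]; simp [asdForm]
  · rw [h5]; simp [asdForm]; module

theorem StructureEquationsB.exists_hasASDEquations {e : Module.Basis (Fin 6) ℝ L}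
    (h : StructureEquationsB e) : ∃ v w, HasASDEquations e v w := by
  obtain ⟨hc, s, t, Y, u, -, -, -, -, h4, h5⟩ := h
  refine ⟨(s * Y) • ![2 * u.re * ‖u‖, -(t * u.re * ‖u‖ * Y), -(2 * s * u.im)],
    (s * Y) • ![2 * (2 * s ^ 2 - u.im) * ‖u‖, t * u.im * ‖u‖ * Y, -(2 * s * u.re)], hc, ?_, ?_⟩
  · rw [h4]; simp [asdForm]; module
  · rw [h5]; simp [asdForm]; module

theorem HasASDEquations.structureEquationsA {e : Module.Basis (Fin 6) ℝ L} {r p : ℝ} (hr : r ≠ 0)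
    (hp : p ≠ 0) (h : HasASDEquations e ![0, r, 0] ![p, 0, -r]) : StructureEquationsA e := by
  have hp2 : -p / 2 ≠ 0 := div_ne_zero (neg_ne_zero.mpr hp) two_ne_zero
  have hts : -p / 2 / (-p / 2 / r) = r := by field_simp
  refine ⟨h.closed, -p / 2 / r, -p / 2, div_ne_zero hp2 hr, hp2, ?_, ?_⟩
  · rw [h.d5, hts]; simp [asdForm]
  · rw [h.d6, hts]; simp [asdForm]; module

/-- A single point of family B, up to scale, suffices for the case |v| = |w|. With s = 3/5 and u =
9i/25 the root √(s² - |u|²) = 12/25 is rational and de⁵ ⊥ de⁶ have equal norms; Y carries the scale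
r, and t = 8/(3Y). -/
theorem HasASDEquations.structureEquationsB {e : Module.Basis (Fin 6) ℝ L} {r : ℝ} (hr : r ≠ 0)
    (h : HasASDEquations e ![0, 0, -r] ![3 / 5 * r, 4 / 5 * r, 0]) : StructureEquationsB e := by
  have hu : ‖(⟨0, 9 / 25⟩ : ℂ)‖ = 9 / 25 := by
    rw [Complex.norm_def, Complex.normSq_mk, show (0 * 0 + 9 / 25 * (9 / 25) : ℝ) = (9 / 25) ^ 2 by
      norm_num, Real.sqrt_sq (by norm_num)]
  have hs : √((3 / 5 : ℝ) ^ 2 - (9 / 25) ^ 2) = 12 / 25 := by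
    rw [show ((3 / 5 : ℝ) ^ 2 - (9 / 25) ^ 2) = (12 / 25) ^ 2 by norm_num,
      Real.sqrt_sq (by norm_num)]
  refine ⟨h.closed, 3 / 5, 8 / (3 * (r * 625 / 162)), r * 625 / 162, ⟨0, 9 / 25⟩, by positivity,
    ?_, ?_, ?_, ?_, ?_⟩
  · rw [hu]; norm_num
  · rw [hu]; norm_num
  · rw [hu, hs]; field_simp; norm_num
  · rw [h.d5, hu]
    funext X Y
    simp [asdForm]
    field_simp
    ring
  · rw [h.d6, hu]
    funext X Y
    simp [asdForm]
    field_simp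
    ring

theorem exists_isStandardAdapted (h5 : IsH5 L) (hA : IsAbelianStructure J)
    (hg : IsHermitianStructure J g) (hb : IsBalanced J g) :
    ∃ e : Module.Basis (Fin 6) ℝ L, IsStandardAdapted J g e := by
  obtain ⟨e, v, w, he, h⟩ := exists_hasASDEquations h5 hA hg hb
  obtain ⟨v, w, h, hvw, hle⟩ := HasASDFrame.exists_orthogonal hg ⟨e, he, h⟩
  have hv : v ≠ 0 := by
    obtain ⟨e, he, h⟩ := h
    exact (h.linearIndependent h5 hg.complex hA he).ne_zero 0
  obtain ⟨r, p, q, hr, hpq, h⟩ := h.exists_normalForm hg hvw hle hv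
  -- Family A has |w|² - |v|² = 4t² > 0, so it covers only the strict case.
  rcases hpq.lt_or_eq with hlt | heq
  · have hpos : 0 < p ^ 2 + q ^ 2 - r ^ 2 := by linarith
    obtain ⟨e, he, h⟩ := h.rotate_normalForm hg (p' := √(p ^ 2 + q ^ 2 - r ^ 2)) (q' := -r)
      (by rw [Real.sq_sqrt hpos.le]; ring)
    exact ⟨e, he, Or.inl (h.structureEquationsA hr (Real.sqrt_pos.mpr hpos).ne')⟩
  · have h := (h.rotate_normalForm hg (p' := 3 / 5 * r) (q' := 4 / 5 * r)
      (by linear_combination heq)).rotate_phase hg (c := 0) (s := -1) (by norm_num)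
    simp at h
    obtain ⟨e, he, h⟩ := h
    exact ⟨e, he, Or.inr (h.structureEquationsB hr)⟩

end StandardBases

/-! ### The solutions of the Strominger system. -/

/-- Let `M = Γ \ G` be a nilmanifold with underlying Lie algebra isomorphic to `𝔥₅`, `J` an abelian
complex structure on it, and `(J, g)` an invariant balanced Hermitian structure. There are explicit
adapted bases, and for each of them `A_lam`, with `lam ≠ 0` small, is an invariant
`SU(3)`-instanton solving the Strominger system with respect to the Bismut connection. -/
theorem theorem5p5 {G : Type*} [TopologicalSpace G] [T2Space G] [SimplyConnectedSpace G]
    [ChartedSpace (EuclideanSpace ℝ (Fin 6)) G] [Group G] [LieGroup (𝓡 6) ∞ G]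
    (Γ : Subgroup G) [DiscreteTopology Γ] [CompactSpace (MulAction.orbitRel.Quotient Γ G)]
    (h5 : IsH5 (LieAlg G))
    (J : LieAlg G →ₗ[ℝ] LieAlg G) (hJ : IsAbelianStructure J)
    (g : LieAlg G →ₗ[ℝ] LieAlg G →ₗ[ℝ] ℝ)
    (hg : IsHermitianStructure J g) (hb : IsBalanced J g) :
    ∃ N : LieAlg G →ₗ[ℝ] LieAlg G →ₗ[ℝ] LieAlg G, IsBismut J g N ∧
      (∃ e : Module.Basis (Fin 6) ℝ (LieAlg G), IsStandardAdapted J g e) ∧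
      ∀ e : Module.Basis (Fin 6) ℝ (LieAlg G), IsStandardAdapted J g e →
        ∃ lam₀ : ℝ, 0 < lam₀ ∧ ∀ lam : ℝ, lam ≠ 0 → |lam| < lam₀ →
          ∃ alpha : ℝ, 0 < alpha ∧ SolvesStrominger Γ J g e N (connA e lam) alpha := by
  obtain ⟨e₀, he₀⟩ := exists_isStandardAdapted h5 hJ hg hb
  have hasd : ∀ e, IsStandardAdapted J g e → ∃ v w, HasASDEquations e v w := fun e he =>
    he.2.elim StructureEquationsA.exists_hasASDEquations
      StructureEquationsB.exists_hasASDEquations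
  obtain ⟨v₀, w₀, h₀⟩ := hasd e₀ he₀
  have hN := he₀.1.isBismut hg.complex h₀
  refine ⟨_, hN, ⟨e₀, he₀⟩, fun e he => ?_⟩
  obtain ⟨v, w, h⟩ := hasd e he
  have hN' := he.1.isBismut hg.complex h
  have hvw : v + w ≠ 0 := fun h0 => by
    have := LinearIndependent.pair_iff.mp (h.linearIndependent h5 hg.complex hJ he.1) 1 1
      (by simpa using h0)
    exact one_ne_zero this.1
  obtain ⟨lam₀, hpos, hlam⟩ := he.1.exists_anomaly hg.complex h hvw
  refine ⟨lam₀, hpos, fun lam hne hlt => ?_⟩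
  obtain ⟨alpha, ha, hd⟩ := hlam lam hlt
  refine ⟨alpha, ha, ?_⟩
  -- The Bismut connection was built from `e₀`; uniqueness allows computing it in the frame `e`.
  rw [IsBismut.unique hg hN hN']
  exact ⟨hg, he.1, hN',
    holonomy_subset_stabSU3 Γ hg he.1 hN'.metric hN'.almostComplex
      (preservesVolForm_asdConnection e _ _),
    hb, he.1.isSU3Instanton hg.complex h hvw hne, ha, hd⟩
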